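/- Algebraic branching programs (ABPs). Let $\mathbb F$ be a field and let $\mathbb F\{x_1,\dots,x_n\}$ be the ring of polynomials in noncommuting variables. An ABP $P$ of depth $d$ consists of nonempty levels $0,1,\dots,d$ of vertices (gates), where level $0$ has exactly one gate (the source) and level $d$ has exactly one gate (the sink), together with, for every pair of a gate $u$ in level $i$ and a gate $v$ in level $i+1$, an edge labeled with a homogeneous linear form in $x_1,\dots,x_n$ over $\mathbb F$ (possibly the zero form, which stands for a missing edge). The size $s$ of $P$ is its number of gates. A gate computes the sum, over all paths from the source to it, of the product of the edge labels in the order of the path (the source computes $1$); $P$ computes the polynomial of its sink. Black-box access. Gates are addressed by (level, number within the level); the algorithm is given $n$, $d$ and the number of gates in each level, but no information on the labels. It may choose a gate, a dimension $k$ and matrices $A_1,\dots,A_n\in M_k(\mathbb F)$, and receives the value in $M_k(\mathbb F)$ at $(A_1,\dots,A_n)$ of the polynomial computed at that gate; such a query costs $1+(n+1)k^2$ steps (plus the evaluation of its arguments), so that only polynomially bounded $k$ can be used in polynomial time. The algorithm is a deterministic program with loops, branching, variables for natural numbers and arrays of natural numbers and of field elements (indexed by tuples of natural numbers). Additions, truncated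 subtractions and comparisons of natural numbers, array accesses, and additions, subtractions, multiplications, inversions and zero tests in $\mathbb F$ cost one step each; the only field constants of the program are $0$ and $1$. Theorem. There are one such program and one polynomial $p$ such that, for every field $\mathbb F$, every $n\ge 0$ and every ABP $P$ of size $s$ and depth $d$ over $\mathbb F\{x_1,\dots,x_n\}$ given by black-box access to all its gates, the program halts after at most $p(d+s+n)$ steps and outputs (the depth, the number of gates of each level, and the coefficients of all edge labels of) an ABP $P'$ of size at most $p(d+s+n)$ which computes the same polynomial in $\mathbb F\{x_1,\dots,x_n\}$ as $P$. That is, an ABP equivalent to $P$ can be computed in deterministic time $\mathrm{poly}(d,s,n)$. -/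

import Mathlib

/-!  Noncommutative algebraic branching programs, and a deterministic machine model
(while programs over arrays of natural numbers and of field elements, with a step count)
that accesses such a branching program through a black box only.  -/

noncomputable section

/-- An algebraic branching program (ABP) over `F` in the noncommuting variables
`x_0, …, x_{n-1}`. Its vertices (gates) are the pairs `(i, j)` with level `i ≤ depth` and
`j < width i`; level `0` consists of the source and level `depth` of the sink. There is an edge
from every gate `(i, j)` to every gate `(i + 1, j')`, labeled with the homogeneous linear form
`∑ v, label i j j' v • x_v`, which may be zero (a missing edge). Values of `width` and `label`
outside these ranges carry no meaning and are never used. -/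
structure ABP (F : Type*) [Field F] (n : ℕ) where
  depth : ℕ
  width : ℕ → ℕ
  label : ℕ → ℕ → ℕ → Fin n → F
  width_pos : ∀ i ≤ depth, 0 < width i
  width_source : width 0 = 1
  width_sink : width depth = 1

namespace ABP

variable {F : Type*} [Field F] {n : ℕ}

/-- The number of vertices. -/
def size (P : ABP F n) : ℕ := ∑ i ∈ Finset.range (P.depth + 1), P.width i

/-- The linear form labeling the edge from gate `(i, j)` to gate `(i + 1, j')`. -/
def edge (P : ABP F n) (i j j' : ℕ) : FreeAlgebra F (Fin n) :=
  ∑ v : Fin n, P.label i j j' v • FreeAlgebra.ι F v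

/-- The noncommutative polynomial computed at gate `(i, j)`: the sum, over all paths from the
source to the gate, of the product of the labels along the path, in the order of the path. -/
def gatePoly (P : ABP F n) : ℕ → ℕ → FreeAlgebra F (Fin n)
  | 0, _ => 1
  | i + 1, j' => ∑ j ∈ Finset.range (P.width i), P.gatePoly i j * P.edge i j j'

/-- The polynomial computed by the program, i.e. at its sink. -/
def poly (P : ABP F n) : FreeAlgebra F (Fin n) := P.gatePoly P.depth 0

end ABP

/-- A black box: a query consists of a gate `(i, j)`, a dimension `k` and `k × k` matrices
`A_0, …, A_{n-1}`; the answer is a `k × k` matrix, or `none` if there is no such gate. -/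
abbrev BlackBox (F : Type*) (n : ℕ) : Type _ :=
  ℕ → ℕ → (k : ℕ) → (Fin n → Matrix (Fin k) (Fin k) F) → Option (Matrix (Fin k) (Fin k) F)

/-- The black box of an ABP evaluates the polynomial computed at the queried gate. -/
def ABP.blackBox {F : Type*} [Field F] {n : ℕ} (P : ABP F n) : BlackBox F n :=
  fun i j _ A =>
    if i ≤ P.depth ∧ j < P.width i then some (FreeAlgebra.lift F A (P.gatePoly i j)) else none

/-! ### The machine model -/

namespace Machine

/-- Indices into arrays are quadruples of natural numbers. -/
abbrev Index : Type := ℕ × ℕ × ℕ × ℕ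

/-- The memory: variables holding a natural number, arrays of natural numbers, and arrays of
field elements. Variables and arrays are named by natural numbers. -/
structure Store (F : Type*) where
  nvar : ℕ → ℕ
  narr : ℕ → Index → ℕ
  farr : ℕ → Index → F

/-- Expressions for natural numbers: only addition and truncated subtraction are available, so
that the numbers which occur in `t` steps have `O(t)` bits. -/
inductive NExp : Type
  | const (c : ℕ)
  | var (x : ℕ)
  | arr (a : ℕ) (i j k l : NExp)
  | add (e e' : NExp)
  | sub (e e' : NExp)

/-- Expressions for field elements; the only constants are `0` and `1`. -/
inductive FExp : Type
  | zero
  | one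
  | arr (a : ℕ) (i j k l : NExp)
  | add (f f' : FExp)
  | sub (f f' : FExp)
  | mul (f f' : FExp)
  | inv (f : FExp)

/-- Tests. A field element can be inspected only by comparing it with zero. -/
inductive BExp : Type
  | le (e e' : NExp)
  | isZero (f : FExp)
  | not (b : BExp)
  | and (b b' : BExp)

/-- Programs. They are finite syntactic objects that do not mention the field. -/
inductive Prog : Type
  | skip
  | setVar (x : ℕ) (e : NExp)
  | setNArr (a : ℕ) (i j k l : NExp) (e : NExp)
  | setFArr (a : ℕ) (i j k l : NExp) (f : FExp)
  /-- Query the black box at the gate number `gate` of level `level`, on `dim × dim` matrices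
  taken from the field array `inp`; the answer is put into the field array `out`. -/
  | query (level gate dim : NExp) (inp out : ℕ)
  | seq (p q : Prog)
  | ite (b : BExp) (p q : Prog)
  | while (b : BExp) (p : Prog)

namespace NExp

def eval {F : Type*} (σ : Store F) : NExp → ℕ
  | const c => c
  | var x => σ.nvar x
  | arr a i j k l => σ.narr a (i.eval σ, j.eval σ, k.eval σ, l.eval σ)
  | add e e' => e.eval σ + e'.eval σ
  | sub e e' => e.eval σ - e'.eval σ

/-- The time to evaluate: the number of nodes of the expression. -/
def cost : NExp → ℕ
  | const _ => 1
  | var _ => 1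
  | arr _ i j k l => 1 + i.cost + j.cost + k.cost + l.cost
  | add e e' => 1 + e.cost + e'.cost
  | sub e e' => 1 + e.cost + e'.cost

end NExp

namespace FExp

def eval {F : Type*} [Field F] (σ : Store F) : FExp → F
  | zero => 0
  | one => 1
  | arr a i j k l => σ.farr a (i.eval σ, j.eval σ, k.eval σ, l.eval σ)
  | add f f' => f.eval σ + f'.eval σ
  | sub f f' => f.eval σ - f'.eval σ
  | mul f f' => f.eval σ * f'.eval σ
  | inv f => (f.eval σ)⁻¹

def cost : FExp → ℕ
  | zero => 1
  | one => 1
  | arr _ i j k l => 1 + i.cost + j.cost + k.cost + l.cost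
  | add f f' => 1 + f.cost + f'.cost
  | sub f f' => 1 + f.cost + f'.cost
  | mul f f' => 1 + f.cost + f'.cost
  | inv f => 1 + f.cost

end FExp

namespace BExp

def Holds {F : Type*} [Field F] (σ : Store F) : BExp → Prop
  | le e e' => e.eval σ ≤ e'.eval σ
  | isZero f => f.eval σ = 0
  | not b => ¬ b.Holds σ
  | and b b' => b.Holds σ ∧ b'.Holds σ

def cost : BExp → ℕ
  | le e e' => 1 + e.cost + e'.cost
  | isZero f => 1 + f.cost
  | not b => 1 + b.cost
  | and b b' => 1 + b.cost + b'.cost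

end BExp

namespace Store

variable {F : Type*}

def setVar (σ : Store F) (x m : ℕ) : Store F :=
  { σ with nvar := Function.update σ.nvar x m }

def setNArr (σ : Store F) (a : ℕ) (I : Index) (m : ℕ) : Store F :=
  { σ with narr := Function.update σ.narr a (Function.update (σ.narr a) I m) }

def setFArr (σ : Store F) (a : ℕ) (I : Index) (z : F) : Store F :=
  { σ with farr := Function.update σ.farr a (Function.update (σ.farr a) I z) }

/-- The `n` matrices of dimension `k` found in the field array `a`: entry `(r, c)` of the `v`-th
matrix is the cell `(v, r, c, 0)`. -/
def readMatrices (σ : Store F) (a n k : ℕ) : Fin n → Matrix (Fin k) (Fin k) F :=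
  fun v => Matrix.of fun r c => σ.farr a (v, r, c, 0)

/-- Write the matrix `B` into the field array `a`: entry `(r, c)` goes to the cell
`(r, c, 0, 0)`; all other cells are unchanged. -/
def writeMatrix (σ : Store F) (a : ℕ) {k : ℕ} (B : Matrix (Fin k) (Fin k) F) : Store F :=
  { σ with
    farr := Function.update σ.farr a fun I =>
      if h : I.1 < k ∧ I.2.1 < k ∧ I.2.2 = (0, 0) then B ⟨I.1, h.1⟩ ⟨I.2.1, h.2.1⟩
      else σ.farr a I }

end Store

/-- `Exec O p σ t τ`: the program `p`, run on the memory `σ` with access to the black box `O`,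
halts after exactly `t` steps with memory `τ`. Every operation on numbers or field elements takes
one step. A query with `k × k` matrices takes `1 + (n + 1) * k ^ 2` steps, which accounts for all
entries of the `n` input matrices and of the answer, plus the evaluation of its arguments; a query
to a gate that does not exist blocks the program, which then does not halt. -/
inductive Exec {F : Type*} [Field F] {n : ℕ} (O : BlackBox F n) :
    Prog → Store F → ℕ → Store F → Prop
  | skip (σ) : Exec O .skip σ 1 σ
  | setVar (σ) (x : ℕ) (e : NExp) :
      Exec O (.setVar x e) σ (1 + e.cost) (σ.setVar x (e.eval σ))
  | setNArr (σ) (a : ℕ) (i j k l e : NExp) :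
      Exec O (.setNArr a i j k l e) σ (1 + i.cost + j.cost + k.cost + l.cost + e.cost)
        (σ.setNArr a (i.eval σ, j.eval σ, k.eval σ, l.eval σ) (e.eval σ))
  | setFArr (σ) (a : ℕ) (i j k l : NExp) (f : FExp) :
      Exec O (.setFArr a i j k l f) σ (1 + i.cost + j.cost + k.cost + l.cost + f.cost)
        (σ.setFArr a (i.eval σ, j.eval σ, k.eval σ, l.eval σ) (f.eval σ))
  | query (σ) (level gate dim : NExp) (inp out k : ℕ) (B : Matrix (Fin k) (Fin k) F)
      (hk : dim.eval σ = k)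
      (hB : O (level.eval σ) (gate.eval σ) k (σ.readMatrices inp n k) = some B) :
      Exec O (.query level gate dim inp out) σ
        (1 + level.cost + gate.cost + dim.cost + (n + 1) * k ^ 2) (σ.writeMatrix out B)
  | seq {p q : Prog} {σ τ ρ : Store F} {t u : ℕ} (hp : Exec O p σ t τ) (hq : Exec O q τ u ρ) :
      Exec O (.seq p q) σ (1 + t + u) ρ
  | iteTrue {b : BExp} {p : Prog} (q : Prog) {σ τ : Store F} {t : ℕ} (hb : b.Holds σ)
      (hp : Exec O p σ t τ) : Exec O (.ite b p q) σ (1 + b.cost + t) τ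
  | iteFalse {b : BExp} (p : Prog) {q : Prog} {σ τ : Store F} {t : ℕ} (hb : ¬ b.Holds σ)
      (hq : Exec O q σ t τ) : Exec O (.ite b p q) σ (1 + b.cost + t) τ
  | whileTrue {b : BExp} {p : Prog} {σ τ ρ : Store F} {t u : ℕ} (hb : b.Holds σ)
      (hp : Exec O p σ t τ) (hw : Exec O (.while b p) τ u ρ) :
      Exec O (.while b p) σ (1 + b.cost + t + u) ρ
  | whileFalse {b : BExp} (p : Prog) {σ : Store F} (hb : ¬ b.Holds σ) :
      Exec O (.while b p) σ (1 + b.cost) σ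

/-- The machine is deterministic: running time and final memory are determined. -/
theorem Exec.deterministic {F : Type*} [Field F] {n : ℕ} {O : BlackBox F n} {p : Prog}
    {σ τ τ' : Store F} {t t' : ℕ} (h : Exec O p σ t τ) (h' : Exec O p σ t' τ') :
    t = t' ∧ τ = τ' := by
  induction h generalizing t' τ' with
  | skip => cases h'; exact ⟨rfl, rfl⟩
  | setVar => cases h'; exact ⟨rfl, rfl⟩
  | setNArr => cases h'; exact ⟨rfl, rfl⟩
  | setFArr => cases h'; exact ⟨rfl, rfl⟩
  | query σ level gate dim inp out k B hk hB =>
    cases h' with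
    | query _ _ _ _ _ _ k' B' hk' hB' =>
      obtain rfl : k = k' := hk.symm.trans hk'
      rw [hB] at hB'
      cases hB'
      exact ⟨rfl, rfl⟩
  | seq _ _ ihp ihq =>
    cases h' with
    | seq hp' hq' =>
      obtain ⟨rfl, rfl⟩ := ihp hp'
      obtain ⟨rfl, rfl⟩ := ihq hq'
      exact ⟨rfl, rfl⟩
  | iteTrue q hb _ ih =>
    cases h' with
    | iteTrue _ _ hp' =>
      obtain ⟨rfl, rfl⟩ := ih hp'
      exact ⟨rfl, rfl⟩
    | iteFalse _ hb' _ => exact absurd hb hb'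
  | iteFalse q hb _ ih =>
    cases h' with
    | iteTrue _ hb' _ => exact absurd hb' hb
    | iteFalse _ _ hq' =>
      obtain ⟨rfl, rfl⟩ := ih hq'
      exact ⟨rfl, rfl⟩
  | whileTrue hb _ _ ihp ihw =>
    cases h' with
    | whileTrue _ hp' hw' =>
      obtain ⟨rfl, rfl⟩ := ihp hp'
      obtain ⟨rfl, rfl⟩ := ihw hw'
      exact ⟨rfl, rfl⟩
    | whileFalse _ hb' => exact absurd hb hb'
  | whileFalse p hb =>
    cases h' with
    | whileTrue hb' _ _ => exact absurd hb' hb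
    | whileFalse => exact ⟨rfl, rfl⟩

variable {F : Type*} [Field F] {n : ℕ}

/-- The initial memory for an ABP given as a black box. It contains the number `n` of variables
(variable `0`), the depth (variable `1`) and the number of gates of each level (number array `0`),
so that the gates can be addressed; everything else is zero. In particular it contains nothing
about the labels. -/
def initial (P : ABP F n) : Store F where
  nvar x := if x = 0 then n else if x = 1 then P.depth else 0
  narr a I := if a = 0 ∧ I.1 ≤ P.depth ∧ I.2 = (0, 0, 0) then P.width I.1 else 0
  farr _ _ := 0

/-- The memory `σ` contains a full explicit description of the ABP `Q`: its depth is in variable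
`1`, the number of gates of level `i` in cell `(i, 0, 0, 0)` of the number array `0`, and the
coefficient of `x_v` in the label of the edge from gate `(i, j)` to gate `(i + 1, j')` in cell
`(i, j, j', v)` of the field array `0`. -/
def Describes (σ : Store F) (Q : ABP F n) : Prop :=
  σ.nvar 1 = Q.depth ∧
  (∀ i ≤ Q.depth, σ.narr 0 (i, 0, 0, 0) = Q.width i) ∧
  ∀ i < Q.depth, ∀ j < Q.width i, ∀ j' < Q.width (i + 1), ∀ v : Fin n,
    σ.farr 0 (i, j, j', v) = Q.label i j j' v

end Machine

end

/-!
# Reconstruction of noncommutative algebraic branching programs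

The algorithm treats the levels one after another. To each gate `k` of level `i` it assigns a linear
functional on the forms of degree `i`, given by a node in a system of matrices, such that every gate
polynomial `g j` of this level is `∑ k, φ k (g j) • g k`. Then the value at a gate of level `i + 1`
of the functional `φ k`, followed by a variable `v`, is a valid coefficient of `x_v` in a label of
an equivalent program. The functionals of level `i + 1` are found by Gaussian elimination, which is
performed on the matrices.
-/

/-! The equivalent program keeps the levels of the given one; only new labels have to be found. Let
`g j` be the gate polynomials of level `i`, and suppose there are functionals `φ k` on forms of
degree `i` with `g j = ∑ k, φ k (g j) • g k` (`ABP.Dual`). The `g j` may be linearly dependent: all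
that matters is that `∑ k, φ k ⊗ g k` acts as the identity on their span. Substituting this into the
recursion for a gate polynomial `g'` of the next level gives `g' = ∑ k, g k * ∑ v, ψ k v (g') •
x_v`, where `ψ k v` is `φ k` followed by the variable `v` (`ABP.Dual.gatePoly_succ`). So the numbers
`ψ k v (g')` are admissible labels, whether or not they are the original ones.

A black box can measure them because matrices are weighted automata. If the entry `(a, b)` of the
matrix of `v` is the weight of an edge from node `a` to node `b`, then row 1 (the source), column
`b` of the value of a polynomial is a functional in which every monomial is weighted by its walks
from 1 to `b`. There is one node per gate plus one temporary node, so the dimension is at most `size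
+ 1` (`ABP.rowVec_node`, `ABP.rowVec_temp`).

To continue, functionals `φ' l` are needed with `ψ k v = ∑ l, ψ k v (g' l) • φ' l` on the gates of
level `i + 1`; then they are dual again (`ABP.Dual.succ`). Starting from `φ' = 0`, the functionals
`ψ` are treated one by one. With the residual `ρ = ψ - ∑ l, ψ (g' l) • φ' l` and a pivot gate `k₀`,
the term `(δ_{l k₀} - φ' l (g' k₀)) • ρ / ρ (g' k₀)` is added to each `φ' l`. This makes the
residual of `ψ` vanish and preserves all residuals that vanish already (`ABP.residual_reduce`). Each
`φ' l` is a combination of the `ψ k v`, with coefficients in the column of its node, so the update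
is a column operation (`ABP.probe_reduce`).

Memory: the field arrays hold the labels (0), the matrices (1), the last answer (2), the pivot value
(3) and the multiplier of the current row (4). Variables 2 and 3 hold the level and its offset; 4 to
9 hold `k`, `v`, the pivot, the row, the matrix and an innermost index. Nested loops use increasing
variables, so a loop body preserves all variables below a threshold. -/

noncomputable section

open Machine Finset

/-! ### Program rules with time bounds. -/

namespace Machine

section Hoare

variable {F : Type*} [Field F] {n : ℕ}

/-- Running `p` on `σ` takes at most `T` steps and ends in a memory satisfying `Q`. -/
def Runs (O : BlackBox F n) (p : Prog) (σ : Store F) (T : ℕ) (Q : Store F → Prop) : Prop :=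
  ∃ t τ, Exec O p σ t τ ∧ t ≤ T ∧ Q τ

variable {O : BlackBox F n} {p q : Prog} {σ : Store F} {T U : ℕ} {Q Q' : Store F → Prop}

theorem Runs.mono (h : Runs O p σ T Q) (hT : T ≤ U) (hQ : ∀ τ, Q τ → Q' τ) :
    Runs O p σ U Q' := by
  obtain ⟨t, τ, he, ht, hq⟩ := h
  exact ⟨t, τ, he, ht.trans hT, hQ τ hq⟩

theorem Runs.seq (hp : Runs O p σ T Q') (hq : ∀ τ, Q' τ → Runs O q τ U Q) :
    Runs O (.seq p q) σ (1 + T + U) Q := by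
  obtain ⟨t, τ, he, ht, hτ⟩ := hp
  obtain ⟨u, ρ, hf, hu, hρ⟩ := hq τ hτ
  exact ⟨_, ρ, .seq he hf, by omega, hρ⟩

theorem Runs.setVar {x : ℕ} {e : NExp} (hQ : Q (σ.setVar x (e.eval σ))) :
    Runs O (.setVar x e) σ (1 + e.cost) Q :=
  ⟨_, _, .setVar σ x e, le_rfl, hQ⟩

theorem Runs.setFArr {a : ℕ} {i j k l : NExp} {f : FExp}
    (hQ : Q (σ.setFArr a (i.eval σ, j.eval σ, k.eval σ, l.eval σ) (f.eval σ))) :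
    Runs O (.setFArr a i j k l f) σ
      (1 + i.cost + j.cost + k.cost + l.cost + f.cost) Q :=
  ⟨_, _, .setFArr σ a i j k l f, le_rfl, hQ⟩

theorem Runs.query {level gate dim : NExp} {inp out k : ℕ} {B : Matrix (Fin k) (Fin k) F}
    (hk : dim.eval σ = k)
    (hB : O (level.eval σ) (gate.eval σ) k (σ.readMatrices inp n k) = some B)
    (hQ : Q (σ.writeMatrix out B)) :
    Runs O (.query level gate dim inp out) σ
      (1 + level.cost + gate.cost + dim.cost + (n + 1) * k ^ 2) Q :=
  ⟨_, _, .query σ level gate dim inp out k B hk hB, le_rfl, hQ⟩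

/-- The loop `for x := 0, …, e - 1 do p`. -/
def forLoop (x : ℕ) (e : NExp) (p : Prog) : Prog :=
  .seq (.setVar x (.const 0))
    (.while (.le (.add (.var x) (.const 1)) e)
      (.seq p (.setVar x (.add (.var x) (.const 1)))))

/-- A bound for the running time of a loop with at most `X` rounds of at most `T` steps. It is
defined over any semiring, so that it can be read as a polynomial. -/
def loopTime {R : Type*} [CommSemiring R] (X T : R) : R := (X + 1) * (T + 25)

/-- Induction on the number `r` of remaining rounds. The test `x + 1 ≤ e` expresses `x < e`. Besides
the body and `e`, a round spends 10 steps on the test, the increment and sequencing. -/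
theorem Runs.whileLoop {x : ℕ} {e : NExp} {M : ℕ} (I : ℕ → Store F → Prop)
    (he : ∀ m τ, I m τ → τ.nvar x = m ∧ e.eval τ = M)
    (hb : ∀ m < M, ∀ τ, I m τ → Runs O p τ T fun ρ => I (m + 1) (ρ.setVar x (ρ.nvar x + 1)))
    (hQ : ∀ τ, I M τ → Q τ) (r m : ℕ) (hr : m + r = M) (σ : Store F) (h : I m σ) :
    Runs O (.while (.le (.add (.var x) (.const 1)) e)
      (.seq p (.setVar x (.add (.var x) (.const 1))))) σ
      (r * (T + e.cost + 10) + 5 + e.cost) Q := by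
  induction r generalizing m σ with
  | zero =>
    obtain rfl : m = M := by omega
    obtain ⟨h1, h2⟩ := he _ _ h
    refine ⟨_, σ, .whileFalse _ ?_, ?_, hQ _ h⟩
    · simp [BExp.Holds, NExp.eval, h1, h2]
    · simp only [BExp.cost, NExp.cost]; omega
  | succ r ih =>
    obtain ⟨h1, h2⟩ := he _ _ h
    obtain ⟨t, τ, hx, ht, hτ⟩ := hb m (by omega) σ h
    obtain ⟨u, ρ, hy, hu, hρ⟩ := ih (m + 1) (by omega) _ hτ
    refine ⟨_, ρ, .whileTrue ?_ (.seq hx (.setVar _ _ _)) hy, ?_, hρ⟩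
    · simp only [BExp.Holds, NExp.eval, h1, h2]; omega
    · simp only [BExp.cost, NExp.cost]
      have : (r + 1) * (T + e.cost + 10) = r * (T + e.cost + 10) + (T + e.cost + 10) := by ring
      omega

/-- The rule for loops, with loop invariant `I`. -/
theorem Runs.forLoop {x : ℕ} {e : NExp} {M X : ℕ} (I : ℕ → Store F → Prop) (hc : e.cost ≤ 15)
    (hM : M ≤ X) (h0 : I 0 (σ.setVar x 0))
    (he : ∀ m τ, I m τ → τ.nvar x = m ∧ e.eval τ = M)
    (hb : ∀ m < M, ∀ τ, I m τ → Runs O p τ T fun ρ => I (m + 1) (ρ.setVar x (ρ.nvar x + 1)))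
    (hQ : ∀ τ, I M τ → Q τ) :
    Runs O (forLoop x e p) σ (loopTime X T) Q := by
  refine ((Runs.setVar (Q := fun τ => τ = σ.setVar x 0) rfl).seq
    (U := M * (T + e.cost + 10) + 5 + e.cost) ?_).mono ?_ fun _ => id
  · rintro τ rfl
    exact Runs.whileLoop I he hb hQ M 0 (zero_add M) _ h0
  · simp only [NExp.cost, loopTime]
    -- The constant 25 is the overhead 10 plus the bound 15 on `e.cost`; one further summand `T +
    -- 25` pays for the initialization and the last test.
    have h1 : M * (T + e.cost + 10) ≤ X * (T + 25) := Nat.mul_le_mul hM (by omega)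
    have h2 : (X + 1) * (T + 25) = X * (T + 25) + (T + 25) := by ring
    omega

end Hoare

end Machine

/-! ### Functionals on forms, realized by matrices. -/

namespace ABP

variable {F : Type*} [Field F] {n : ℕ}

/-- The number of the node that represents gate `(i, 0)` in the reconstruction; gate `(i, j)` is
represented by the node `P.offset i + j`. The node `0` is used temporarily. -/
def offset (P : ABP F n) (i : ℕ) : ℕ := 1 + ∑ i' ∈ range i, P.width i'

theorem offset_zero (P : ABP F n) : P.offset 0 = 1 := by simp [offset]

theorem offset_succ (P : ABP F n) (i : ℕ) : P.offset (i + 1) = P.offset i + P.width i := by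
  simp [offset, sum_range_succ, add_assoc]

theorem offset_pos (P : ABP F n) (i : ℕ) : 0 < P.offset i := by simp [offset]

theorem offset_mono (P : ABP F n) : Monotone P.offset :=
  monotone_nat_of_le_succ fun i => by simp [offset_succ]

/-- The first row of the value of the gate `(i, j)` at the `N × N` matrices stored in `A`
(rows are counted from zero). -/
def rowVec (P : ABP F n) (A : Index → F) (N : ℕ) : ℕ → ℕ → ℕ → F
  | 0, _, b => if b = 1 then 1 else 0
  | i + 1, j', b => ∑ j ∈ range (P.width i), ∑ v : Fin n,
      P.label i j j' v * ∑ a ∈ range N, P.rowVec A N i j a * A (v, a, b, 0)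

/-- The value at gate `(i, j)` of the functional represented by the node of gate `(i, k)`. -/
def probe (P : ABP F n) (A : Index → F) : ℕ → ℕ → ℕ → F
  | 0, _, _ => 1
  | i + 1, j', l => ∑ j ∈ range (P.width i), ∑ v : Fin n, P.label i j j' v *
      ∑ k ∈ range (P.width i), P.probe A i j k * A (v, P.offset i + k, P.offset (i + 1) + l, 0)

/-- The value at gate `(i + 1, j')` of the functional represented by the node of gate `(i, k)`
followed by the variable `v`. -/
def extend (P : ABP F n) (A : Index → F) (i k : ℕ) (v : Fin n) (j' : ℕ) : F :=
  ∑ j ∈ range (P.width i), P.label i j j' v * P.probe A i j k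

/-- The part of the functional with values `x` on the gates of level `i + 1` that is not yet
explained by the nodes of this level. -/
def residual (P : ABP F n) (A : Index → F) (i : ℕ) (x : ℕ → F) (j : ℕ) : F :=
  x j - ∑ l ∈ range (P.width (i + 1)), x l * P.probe A (i + 1) j l

/-- All edges between nodes lead from some level to the next one. -/
def Supported (P : ABP F n) (A : Index → F) : Prop :=
  ∀ (v : Fin n) (i a l : ℕ), l < P.width (i + 1) → (a < P.offset i ∨ P.offset (i + 1) ≤ a) →
    A (v, a, P.offset (i + 1) + l, 0) = 0

/-- Evaluation is a homomorphism, and a row of a product depends only on that row of the first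
factor. Hence the row of the source, node 1, obeys a recursion of its own. -/
theorem lift_gatePoly (P : ABP F n) (A : Index → F) {N : ℕ} (hN : 1 < N) (i j : ℕ) (b : Fin N) :
    FreeAlgebra.lift F (fun v : Fin n => Matrix.of fun r c : Fin N => A (v, r, c, 0))
      (P.gatePoly i j) ⟨1, hN⟩ b = P.rowVec A N i j b := by
  induction i generalizing j b with
  | zero =>
    simp [gatePoly, rowVec, Matrix.one_apply, Fin.ext_iff, eq_comm]
  | succ i ih =>
    simp only [gatePoly, rowVec, edge, map_sum, map_mul, Matrix.sum_apply]
    refine sum_congr rfl fun j₁ _ => ?_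
    rw [mul_sum, Matrix.sum_apply]
    refine sum_congr rfl fun v _ => ?_
    rw [map_smul, FreeAlgebra.lift_ι_apply, mul_smul_comm, Matrix.smul_apply, smul_eq_mul,
      Matrix.mul_apply, ← Fin.sum_univ_eq_sum_range (fun a => P.rowVec A N i j₁ a * A (v, a, b, 0))]
    simp only [ih, Matrix.of_apply]

theorem _root_.Finset.sum_range_eq_sum_window {M : Type*} [AddCommMonoid M] (f : ℕ → M)
    {o w N : ℕ} (hN : o + w ≤ N) (h : ∀ a, (a < o ∨ o + w ≤ a) → f a = 0) :
    ∑ a ∈ range N, f a = ∑ k ∈ range w, f (o + k) := by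
  have h1 : ∑ k ∈ range w, f (o + k) = ∑ a ∈ Ico o (o + w), f a := by
    rw [sum_Ico_eq_sum_range]; simp
  rw [h1]
  refine (sum_subset (fun a ha => ?_) fun a _ ha => h a ?_).symm
  · simp only [mem_Ico, mem_range] at *; omega
  · simp only [mem_Ico] at ha; omega

/-- Only the preceding level has edges into the node, so the matrix product collapses to the
recursion of `probe`. In particular neither the dimension nor the temporary node influences the
result. -/
theorem rowVec_node (P : ABP F n) {A : Index → F} (hA : P.Supported A) {N i k : ℕ} (j : ℕ)
    (hN : P.offset (i + 1) ≤ N) (hk : k < P.width i) :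
    P.rowVec A N i j (P.offset i + k) = P.probe A i j k := by
  induction i generalizing j k with
  | zero =>
    obtain rfl : k = 0 := by have := P.width_source; omega
    simp [rowVec, probe, offset_zero]
  | succ i ih =>
    have h1 := P.offset_succ i
    have h2 := P.offset_mono (Nat.le_succ (i + 1))
    simp only [Nat.succ_eq_add_one] at h2
    simp only [rowVec, probe]
    refine sum_congr rfl fun j₁ _ => sum_congr rfl fun v _ => ?_
    rw [sum_range_eq_sum_window _ (o := P.offset i) (w := P.width i) (by omega)]
    · congr 1
      refine sum_congr rfl fun a ha => ?_
      rw [ih _ (by omega) (mem_range.1 ha)]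
    · intro a ha
      rw [hA v i a k hk (by omega), mul_zero]

/-- The only edge into node 0 comes from the node of gate `(i, k)` and carries `v` with weight 1, so
a walk ending there is a walk to that node followed by `v`. -/
theorem rowVec_temp (P : ABP F n) {A : Index → F} (hA : P.Supported A) {N i k : ℕ} {v : Fin n}
    (hT : ∀ (u : Fin n) a, A (u, a, 0, 0) = if u = v ∧ a = P.offset i + k then 1 else 0)
    (j' : ℕ) (hN : P.offset (i + 1) ≤ N) (hk : k < P.width i) :
    P.rowVec A N (i + 1) j' 0 = P.extend A i k v j' := by
  have h1 := P.offset_succ i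
  simp only [rowVec, extend]
  refine sum_congr rfl fun j _ => ?_
  rw [sum_eq_single v]
  · rw [sum_eq_single (P.offset i + k), hT, if_pos ⟨rfl, rfl⟩, mul_one, P.rowVec_node hA j hN hk]
    · intro a _ ha
      rw [hT, if_neg (fun h => ha h.2), mul_zero]
    · intro h; simp only [mem_range] at h; omega
  · intro u _ hu
    rw [sum_eq_zero, mul_zero]
    intro a _
    rw [hT, if_neg (fun h => hu h.1), mul_zero]
  · simp

/-- Functionals of level `i` use only the columns of nodes up to level `i`. This protects them while
level `i + 1` is being eliminated. -/
theorem probe_congr (P : ABP F n) {A A' : Index → F} {i : ℕ}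
    (h : ∀ (v : Fin n) i' a l, i' < i → l < P.width (i' + 1) →
      A (v, a, P.offset (i' + 1) + l, 0) = A' (v, a, P.offset (i' + 1) + l, 0))
    (j : ℕ) {k : ℕ} (hk : k < P.width i) : P.probe A i j k = P.probe A' i j k := by
  induction i generalizing j k with
  | zero => rfl
  | succ i ih =>
    simp only [probe]
    refine sum_congr rfl fun j₁ _ => sum_congr rfl fun v _ => ?_
    congr 1
    refine sum_congr rfl fun a ha => ?_
    rw [ih (fun v i' a l h1 h2 => h v i' a l (h1.trans i.lt_succ_self) h2) j₁ (mem_range.1 ha),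
      h v i _ k i.lt_succ_self hk]

theorem extend_congr (P : ABP F n) {A A' : Index → F} {i : ℕ}
    (h : ∀ (v : Fin n) i' a l, i' < i → l < P.width (i' + 1) →
      A (v, a, P.offset (i' + 1) + l, 0) = A' (v, a, P.offset (i' + 1) + l, 0))
    {k : ℕ} (hk : k < P.width i) (v : Fin n) (j' : ℕ) :
    P.extend A i k v j' = P.extend A' i k v j' :=
  sum_congr rfl fun j _ => by rw [P.probe_congr h j hk]

/-- Exchanging the sums shows that the column of a node consists of the coefficients of its
functional in terms of the functionals `extend`. Column operations thus become linear operations on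
functionals. -/
theorem probe_succ (P : ABP F n) (A : Index → F) (i j' l : ℕ) :
    P.probe A (i + 1) j' l = ∑ k ∈ range (P.width i), ∑ v : Fin n,
      P.extend A i k v j' * A (v, P.offset i + k, P.offset (i + 1) + l, 0) := by
  simp only [probe, extend, sum_mul, mul_sum]
  rw [sum_congr rfl fun j _ => sum_comm, sum_comm]
  refine sum_congr rfl fun k _ => ?_
  rw [sum_comm]
  exact sum_congr rfl fun v _ => sum_congr rfl fun j _ => by ring

/-! ### One elimination step, on matrices and on functionals. -/

/-- The effect of the elimination on one row of matrix entries. -/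
def reduceRow (o w k₀ : ℕ) (r b : ℕ → F) (R : F) (A : Index → F) (I : Index) : F :=
  if o ≤ I.2.2.1 ∧ I.2.2.1 < o + w ∧ I.2.2.2 = 0 then
    A I + ((if I.2.2.1 = o + k₀ then 1 else 0) - b (I.2.2.1 - o)) *
      ((A (I.1, I.2.1, 0, 0) - ∑ l ∈ range w, r l * A (I.1, I.2.1, o + l, 0)) * R⁻¹)
  else A I

/-- The effect of the elimination with pivot `k₀` in level `i + 1` on the array of matrices. -/
def reduce (P : ABP F n) (i k₀ : ℕ) (r b : ℕ → F) (R : F) (A : Index → F) (I : Index) : F :=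
  if I.1 < n ∧ P.offset i ≤ I.2.1 ∧ I.2.1 < P.offset i + P.width i then
    reduceRow (P.offset (i + 1)) (P.width (i + 1)) k₀ r b R A I
  else A I

theorem reduce_of_lt (P : ABP F n) (i k₀ : ℕ) (r b : ℕ → F) (R : F) (A : Index → F) {I : Index}
    (h : I.2.2.1 < P.offset (i + 1)) : P.reduce i k₀ r b R A I = A I := by
  simp [reduce, reduceRow, h.not_ge]

theorem reduce_of_level_ne (P : ABP F n) {i i' : ℕ} (k₀ : ℕ) (r b : ℕ → F) (R : F)
    (A : Index → F) (v a : ℕ) {l : ℕ} (hl : l < P.width (i' + 1)) (h : i' ≠ i) :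
    P.reduce i k₀ r b R A (v, a, P.offset (i' + 1) + l, 0) =
      A (v, a, P.offset (i' + 1) + l, 0) := by
  have : ¬ (P.offset (i + 1) ≤ P.offset (i' + 1) + l ∧
      P.offset (i' + 1) + l < P.offset (i + 1) + P.width (i + 1)) := by
    rintro ⟨h1, h2⟩
    rw [← P.offset_succ] at h2
    rcases lt_or_gt_of_ne h with h | h
    · have := P.offset_mono (Nat.succ_le_succ (Nat.succ_le_of_lt h))
      simp only [Nat.succ_eq_add_one] at this
      have := P.offset_succ (i' + 1)
      omega
    · have := P.offset_mono (Nat.succ_le_succ (Nat.succ_le_of_lt h))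
      simp only [Nat.succ_eq_add_one] at this
      omega
  have h2 : reduceRow (P.offset (i + 1)) (P.width (i + 1)) k₀ r b R A
      (v, a, P.offset (i' + 1) + l, 0) = A (v, a, P.offset (i' + 1) + l, 0) :=
    if_neg fun h => this ⟨h.1, h.2.1⟩
  rw [reduce, h2, ite_self]

theorem reduce_node (P : ABP F n) (i k₀ : ℕ) (r b : ℕ → F) (R : F) (A : Index → F) (v : Fin n)
    {k l : ℕ} (hk : k < P.width i) (hl : l < P.width (i + 1)) :
    P.reduce i k₀ r b R A (v, P.offset i + k, P.offset (i + 1) + l, 0) =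
      A (v, P.offset i + k, P.offset (i + 1) + l, 0) + ((if l = k₀ then 1 else 0) - b l) *
      ((A (v, P.offset i + k, 0, 0) - ∑ l' ∈ range (P.width (i + 1)),
        r l' * A (v, P.offset i + k, P.offset (i + 1) + l', 0)) * R⁻¹) := by
  simp [reduce, reduceRow, hk, hl]

theorem Supported.reduce {P : ABP F n} {A : Index → F} (hA : P.Supported A) (i k₀ : ℕ)
    (r b : ℕ → F) (R : F) : P.Supported (P.reduce i k₀ r b R A) := by
  intro v i' a l hl ha
  by_cases h : i' = i
  · subst h
    rw [ABP.reduce, if_neg, hA v i' a l hl ha]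
    rintro ⟨_, h1, h2⟩
    have := P.offset_succ i'
    dsimp only at h1 h2
    omega
  · rw [reduce_of_level_ne _ _ _ _ _ _ _ _ hl h, hA v i' a l hl ha]

theorem probe_reduce_of_le (P : ABP F n) {i i' : ℕ} (hi : i' ≤ i) (k₀ : ℕ) (r b : ℕ → F) (R : F)
    (A : Index → F) (j : ℕ) {k : ℕ} (hk : k < P.width i') :
    P.probe (P.reduce i k₀ r b R A) i' j k = P.probe A i' j k :=
  P.probe_congr (fun v i'' a l h1 h2 =>
    P.reduce_of_level_ne k₀ r b R A v a h2 (by omega)) j hk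

theorem extend_reduce (P : ABP F n) (i k₀ : ℕ) (r b : ℕ → F) (R : F)
    (A : Index → F) {k : ℕ} (hk : k < P.width i) (v : Fin n) (j : ℕ) :
    P.extend (P.reduce i k₀ r b R A) i k v j = P.extend A i k v j :=
  P.extend_congr (fun v i'' a l h1 h2 =>
    P.reduce_of_level_ne k₀ r b R A v a h2 (by omega)) hk v j

/-- By `probe_succ` a functional is linear in its column, and the correction of the column is a
multiple of the coefficient vector of the residual functional. -/
theorem probe_reduce (P : ABP F n) {A : Index → F} {i k : ℕ} {v : Fin n}
    (hT : ∀ (u : Fin n) a, A (u, a, 0, 0) = if u = v ∧ a = P.offset i + k then 1 else 0)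
    (hk : k < P.width i) (k₀ : ℕ) (b : ℕ → F) (R : F) (r : ℕ → F)
    (hr : ∀ j, r j = P.extend A i k v j) (j : ℕ) {l : ℕ} (hl : l < P.width (i + 1)) :
    P.probe (P.reduce i k₀ r b R A) (i + 1) j l = P.probe A (i + 1) j l +
      ((if l = k₀ then 1 else 0) - b l) * (P.residual A i r j * R⁻¹) := by
  -- Column 0 is the coefficient vector of the functional being treated; subtracting the node
  -- columns with weights `r` leaves that of its residual.
  have key : P.residual A i r j = ∑ k' ∈ range (P.width i), ∑ u : Fin n,
      P.extend A i k' u j * (A (u, P.offset i + k', 0, 0) - ∑ l' ∈ range (P.width (i + 1)),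
        r l' * A (u, P.offset i + k', P.offset (i + 1) + l', 0)) := by
    simp only [mul_sub, sum_sub_distrib, residual]
    congr 1
    · rw [sum_eq_single k, sum_eq_single v, hT, if_pos ⟨rfl, rfl⟩, mul_one, hr]
      · intro u _ hu; rw [hT, if_neg (fun h => hu h.1), mul_zero]
      · simp
      · intro k' _ hk'
        refine sum_eq_zero fun u _ => ?_
        rw [hT, if_neg (fun h => hk' (by omega)), mul_zero]
      · intro h; exact absurd (mem_range.2 hk) h
    · simp only [probe_succ, mul_sum]
      rw [sum_comm]
      refine sum_congr rfl fun k' _ => ?_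
      rw [sum_comm]
      exact sum_congr rfl fun u _ => sum_congr rfl fun l' _ => by ring
  rw [key, probe_succ, probe_succ, sum_mul, mul_sum, ← sum_add_distrib]
  refine sum_congr rfl fun k' hk' => ?_
  rw [sum_mul, mul_sum, ← sum_add_distrib]
  refine sum_congr rfl fun u _ => ?_
  rw [P.extend_reduce _ _ _ _ _ _ (mem_range.1 hk'), P.reduce_node _ _ _ _ _ _ _
    (mem_range.1 hk') hl]
  ring

/-- The weights `δ_{l k₀} - b l`, summed against `x`, give exactly the old residual of `x` at `k₀`;
so this is a rank one update. For `x = r` and `R` the nonzero residual at `k₀`, the right side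
vanishes for every `j`. -/
theorem residual_reduce (P : ABP F n) {A : Index → F} {i k : ℕ} {v : Fin n}
    (hT : ∀ (u : Fin n) a, A (u, a, 0, 0) = if u = v ∧ a = P.offset i + k then 1 else 0)
    (hk : k < P.width i) {k₀ : ℕ} (hk₀ : k₀ < P.width (i + 1)) (b : ℕ → F) (R : F) (r : ℕ → F)
    (hr : ∀ j, r j = P.extend A i k v j)
    (hb : ∀ l < P.width (i + 1), b l = P.probe A (i + 1) k₀ l) (x : ℕ → F) (j : ℕ) :
    P.residual (P.reduce i k₀ r b R A) i x j =
      P.residual A i x j - P.residual A i x k₀ * (P.residual A i r j * R⁻¹) := by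
  have h1 : ∑ l ∈ range (P.width (i + 1)), x l * P.probe (P.reduce i k₀ r b R A) (i + 1) j l =
      ∑ l ∈ range (P.width (i + 1)), x l * P.probe A (i + 1) j l +
        (∑ l ∈ range (P.width (i + 1)), (if l = k₀ then x l else 0) -
          ∑ l ∈ range (P.width (i + 1)), x l * P.probe A (i + 1) k₀ l) *
          (P.residual A i r j * R⁻¹) := by
    rw [← sum_sub_distrib, sum_mul, ← sum_add_distrib]
    refine sum_congr rfl fun l hl => ?_
    rw [P.probe_reduce hT hk _ _ _ _ hr _ (mem_range.1 hl), hb l (mem_range.1 hl)]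
    split_ifs <;> ring
  rw [sum_ite_eq' (range (P.width (i + 1))) k₀ x, if_pos (mem_range.2 hk₀)] at h1
  rw [residual, h1]
  simp only [residual]
  ring

/-! ### Dual systems of functionals and admissible labels. -/

/-- The nodes of level `i` form a system of dual functionals for the gates of this level. -/
def Dual (P : ABP F n) (A : Index → F) (i : ℕ) : Prop :=
  ∀ j < P.width i, P.gatePoly i j = ∑ k ∈ range (P.width i), P.probe A i j k • P.gatePoly i k

theorem dual_zero (P : ABP F n) (A : Index → F) : P.Dual A 0 := by
  intro j _
  simp [P.width_source, gatePoly, probe]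

/-- Each gate polynomial of level `i` is expanded by duality and the terms with the same right-hand
gate are collected. The unknown labels then enter only through values that a query can measure. -/
theorem Dual.gatePoly_succ {P : ABP F n} {A : Index → F} {i : ℕ} (h : P.Dual A i) (j' : ℕ) :
    P.gatePoly (i + 1) j' = ∑ k ∈ range (P.width i), P.gatePoly i k *
      ∑ v : Fin n, P.extend A i k v j' • FreeAlgebra.ι F v := by
  have h1 : P.gatePoly (i + 1) j' = ∑ j ∈ range (P.width i), ∑ k ∈ range (P.width i),
      P.gatePoly i k * ∑ v : Fin n, (P.label i j j' v * P.probe A i j k) • FreeAlgebra.ι F v := by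
    rw [gatePoly]
    refine sum_congr rfl fun j hj => ?_
    conv_lhs => rw [h j (mem_range.1 hj), sum_mul]
    refine sum_congr rfl fun k _ => ?_
    rw [edge, mul_sum, mul_sum]
    refine sum_congr rfl fun v _ => ?_
    rw [mul_smul_comm, mul_smul_comm, smul_mul_assoc, smul_smul]
  rw [h1, sum_comm]
  refine sum_congr rfl fun k _ => ?_
  rw [← mul_sum, sum_comm]
  congr 1
  refine sum_congr rfl fun v _ => ?_
  rw [extend, sum_smul]

/-- Vanishing residuals express each value `extend` at gate `j` through its values at the gates `l`,
with factors independent of `k` and `v`. These factors come out of the formula `Dual.gatePoly_succ`,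
and what remains is the same formula for gate `l`. -/
theorem Dual.succ {P : ABP F n} {A : Index → F} {i : ℕ} (h : P.Dual A i)
    (hr : ∀ k < P.width i, ∀ v, ∀ j < P.width (i + 1), P.residual A i (P.extend A i k v) j = 0) :
    P.Dual A (i + 1) := by
  intro j hj
  rw [h.gatePoly_succ j]
  simp only [h.gatePoly_succ]
  have h1 : ∀ k ∈ range (P.width i), P.gatePoly i k * ∑ v : Fin n,
      P.extend A i k v j • FreeAlgebra.ι F v = ∑ l ∈ range (P.width (i + 1)),
        P.probe A (i + 1) j l • (P.gatePoly i k * ∑ v : Fin n,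
          P.extend A i k v l • FreeAlgebra.ι F v) := by
    intro k hk
    simp only [← mul_smul_comm]
    rw [← mul_sum]
    congr 1
    simp only [smul_sum]
    rw [sum_comm]
    refine sum_congr rfl fun v _ => ?_
    rw [sub_eq_zero.1 (hr k (mem_range.1 hk) v j hj), sum_smul]
    exact sum_congr rfl fun l _ => by rw [smul_smul, mul_comm]
  rw [sum_congr rfl h1, sum_comm]
  exact sum_congr rfl fun l _ => smul_sum.symm

theorem Dual.congr {P : ABP F n} {A A' : Index → F} {i : ℕ} (h : P.Dual A i)
    (hA : ∀ j, ∀ k < P.width i, P.probe A' i j k = P.probe A i j k) : P.Dual A' i := by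
  intro j hj
  rw [sum_congr rfl fun k hk => by rw [hA j k (mem_range.1 hk)]]
  exact h j hj

end ABP

/-! ### Frame conditions for the memory. -/

namespace Machine

/-- The memory `τ` agrees with `σ` on the variables below `c`, on the arrays of numbers and on the
field arrays not in `S`. -/
structure Same {F : Type*} (c : ℕ) (S : Finset ℕ) (σ τ : Store F) : Prop where
  narr : τ.narr = σ.narr
  nvar : ∀ x < c, τ.nvar x = σ.nvar x
  farr : ∀ a ∉ S, τ.farr a = σ.farr a

namespace Same

variable {F : Type*} {c : ℕ} {S : Finset ℕ} {σ τ ρ : Store F}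

theorem refl (c : ℕ) (S : Finset ℕ) (σ : Store F) : Same c S σ σ :=
  ⟨rfl, fun _ _ => rfl, fun _ _ => rfl⟩

theorem trans (h : Same c S σ τ) (h' : Same c S τ ρ) : Same c S σ ρ :=
  ⟨h'.narr.trans h.narr, fun x hx => (h'.nvar x hx).trans (h.nvar x hx),
    fun a ha => (h'.farr a ha).trans (h.farr a ha)⟩

theorem mono {c' : ℕ} {S' : Finset ℕ} (h : Same c S σ τ) (hc : c' ≤ c) (hS : S ⊆ S') :
    Same c' S' σ τ :=
  ⟨h.narr, fun x hx => h.nvar x (hx.trans_le hc), fun a ha => h.farr a fun h' => ha (hS h')⟩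

theorem setVar (h : Same c S σ τ) {x : ℕ} (hx : c ≤ x) (m : ℕ) : Same c S σ (τ.setVar x m) :=
  ⟨h.narr, fun y hy => by
    rw [← h.nvar y hy]; exact Function.update_of_ne (by omega) _ _, h.farr⟩

theorem setFArr (h : Same c S σ τ) {a : ℕ} (ha : a ∈ S) (I : Index) (z : F) :
    Same c S σ (τ.setFArr a I z) :=
  ⟨h.narr, h.nvar, fun b hb => by
    rw [← h.farr b hb]; exact Function.update_of_ne (ne_of_mem_of_not_mem ha hb).symm _ _⟩

end Same

namespace Store

variable {F : Type*} (σ : Store F)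

@[simp] theorem setVar_nvar_self (x m : ℕ) : (σ.setVar x m).nvar x = m :=
  Function.update_self ..

theorem setVar_nvar_of_ne {x y : ℕ} (m : ℕ) (h : y ≠ x) : (σ.setVar x m).nvar y = σ.nvar y :=
  Function.update_of_ne h ..

@[simp] theorem setVar_farr (x m : ℕ) : (σ.setVar x m).farr = σ.farr := rfl

@[simp] theorem setVar_narr (x m : ℕ) : (σ.setVar x m).narr = σ.narr := rfl

@[simp] theorem setFArr_nvar (a : ℕ) (I : Index) (z : F) : (σ.setFArr a I z).nvar = σ.nvar := rfl

theorem setFArr_farr_self (a : ℕ) (I : Index) (z : F) (J : Index) :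
    (σ.setFArr a I z).farr a J = if J = I then z else σ.farr a J := by
  simp [setFArr, Function.update_apply]

theorem setFArr_farr_of_ne {a b : ℕ} (I : Index) (z : F) (h : b ≠ a) :
    (σ.setFArr a I z).farr b = σ.farr b :=
  Function.update_of_ne h ..

end Store

end Machine

/-! ### The program and its time bounds. -/

namespace ABP

open NExp Prog

/-- The cell of a field array that serves as a scalar variable. -/
abbrev scalar (a : ℕ) : FExp := .arr a (const 0) (const 0) (const 0) (const 0)

/-- The assignment to a scalar variable. -/
abbrev setScalar (a : ℕ) (f : FExp) : Prog := .setFArr a (const 0) (const 0) (const 0) (const 0) f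

/-- The number of gates of the current level. -/
abbrev widthExp : NExp := .arr 0 (var 2) (const 0) (const 0) (const 0)

/-- The number of gates of the next level. -/
abbrev nextWidthExp : NExp := .arr 0 (add (var 2) (const 1)) (const 0) (const 0) (const 0)

/-- The offset of the next level. -/
abbrev nextOffsetExp : NExp := add (var 3) widthExp

/-- The label of the new branching program that belongs to the functional under consideration. -/
abbrev labelExp : FExp := .arr 0 (var 2) (var 4) (var 9) (var 5)

/-- An entry of the first row of the answer to the last query. -/
abbrev answerExp : FExp := .arr 2 (const 1) (add nextOffsetExp (var 9)) (const 0) (const 0)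

/-- An entry of the matrices. -/
abbrev entryExp (x : ℕ) : FExp :=
  .arr 1 (var 8) (add (var 3) (var 7)) (add nextOffsetExp (var x)) (const 0)

/-- Subtract the products `f * g` from the scalar variable `a`. -/
def accumulate (a : ℕ) (f g : FExp) : Prog :=
  forLoop 9 nextWidthExp (setScalar a (.sub (scalar a) (.mul f g)))

/-- The elimination in one row of one matrix. -/
def eliminateRow : Prog :=
  .seq (setScalar 4 (.arr 1 (var 8) (add (var 3) (var 7)) (const 0) (const 0))) <|
  .seq (accumulate 4 labelExp (entryExp 9)) <|
  .seq (setScalar 4 (.mul (scalar 4) (.inv (scalar 3)))) <|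
  .seq (forLoop 9 nextWidthExp (.setFArr 1 (var 8) (add (var 3) (var 7))
    (add nextOffsetExp (var 9)) (const 0) (.sub (entryExp 9) (.mul answerExp (scalar 4)))))
  (.setFArr 1 (var 8) (add (var 3) (var 7)) (add nextOffsetExp (var 6)) (const 0)
    (.add (entryExp 6) (scalar 4)))

/-- Evaluate the gate of the next level whose number is in variable `x`. -/
def evaluate (x : ℕ) : Prog :=
  .query (add (var 2) (const 1)) (var x) (add nextOffsetExp nextWidthExp) 1 2

/-- The elimination with one pivot. -/
def eliminate : Prog :=
  .seq (evaluate 6) <|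
  .seq (setScalar 3 (.arr 2 (const 1) (const 0) (const 0) (const 0))) <|
  .seq (accumulate 3 labelExp answerExp)
  (forLoop 7 widthExp (forLoop 8 (var 0) eliminateRow))

/-- Compute the labels that belong to one functional. -/
def computeLabels : Prog :=
  forLoop 9 nextWidthExp (.seq (evaluate 9)
    (.setFArr 0 (var 2) (var 4) (var 9) (var 5) (.arr 2 (const 1) (const 0) (const 0) (const 0))))

/-- Write an entry of the column of the temporary node. -/
abbrev setTemp (f : FExp) : Prog := .setFArr 1 (var 5) (add (var 3) (var 4)) (const 0) (const 0) f

/-- Treat one functional. -/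
def processFunctional : Prog :=
  .seq (setTemp .one) <|
  .seq computeLabels <|
  .seq (forLoop 6 nextWidthExp eliminate)
  (setTemp .zero)

/-- Treat one level. -/
def processLevel : Prog :=
  .seq (forLoop 4 widthExp (forLoop 5 (var 0) processFunctional))
  (.setVar 3 nextOffsetExp)

/-- The reconstruction algorithm. -/
def reconstruct : Prog :=
  .seq (.setVar 3 (const 1)) (forLoop 2 (var 1) processLevel)

section Time

variable {R : Type*} [CommSemiring R]

/-- A bound for the running time of `eliminateRow`. -/
def rowTime (X : R) : R := loopTime X 100 + loopTime X 100 + 400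

/-- A bound for the running time of `evaluate`. -/
def queryTime (X : R) : R := (X + 1) * (X + 1) ^ 2 + 100

/-- A bound for the running time of `eliminate`. -/
def eliminateTime (X : R) : R :=
  queryTime X + loopTime X 100 + loopTime X (loopTime X (rowTime X)) + 200

/-- A bound for the running time of `processFunctional`. -/
def functionalTime (X : R) : R :=
  loopTime X (queryTime X + 100) + loopTime X (eliminateTime X) + 200

/-- A bound for the running time of `processLevel`. -/
def levelTime (X : R) : R := loopTime X (loopTime X (functionalTime X)) + 100

/-- A bound for the running time of `reconstruct`. -/
def totalTime (X : R) : R := loopTime X (levelTime X) + 100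

end Time

variable {F : Type*} [Field F] {n : ℕ}

/-! ### Correctness of elimination and queries. -/

/-- The memory is prepared for the treatment of level `i`. -/
structure AtLevel (P : ABP F n) (i : ℕ) (σ : Store F) : Prop where
  lt : i < P.depth
  var_zero : σ.nvar 0 = n
  var_two : σ.nvar 2 = i
  var_three : σ.nvar 3 = P.offset i
  width : ∀ m ≤ P.depth, σ.narr 0 (m, 0, 0, 0) = P.width m

namespace AtLevel

variable {P : ABP F n} {i : ℕ} {σ τ : Store F}

theorem of_same (h : P.AtLevel i σ) {c : ℕ} {S : Finset ℕ} (hs : Same c S σ τ) (hc : 4 ≤ c) :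
    P.AtLevel i τ :=
  ⟨h.lt, (hs.nvar 0 (by omega)).trans h.var_zero, (hs.nvar 2 (by omega)).trans h.var_two,
    (hs.nvar 3 (by omega)).trans h.var_three, fun m hm => by rw [hs.narr]; exact h.width m hm⟩

theorem eval_width (h : P.AtLevel i σ) : widthExp.eval σ = P.width i := by
  simp only [NExp.eval, h.var_two, h.width i h.lt.le]

theorem eval_nextWidth (h : P.AtLevel i σ) : nextWidthExp.eval σ = P.width (i + 1) := by
  simp only [NExp.eval, h.var_two, h.width (i + 1) h.lt]

theorem eval_nextOffset (h : P.AtLevel i σ) : nextOffsetExp.eval σ = P.offset (i + 1) := by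
  rw [NExp.eval, h.eval_width, NExp.eval, h.var_three, offset_succ]

end AtLevel

theorem width_le_size (P : ABP F n) {i : ℕ} (hi : i ≤ P.depth) : P.width i ≤ P.size :=
  single_le_sum (f := P.width) (fun _ _ => Nat.zero_le _) (mem_range.2 (Nat.lt_succ_of_le hi))

theorem offset_le_size (P : ABP F n) {i : ℕ} (hi : i ≤ P.depth + 1) :
    P.offset i ≤ P.size + 1 := by
  rw [add_comm]
  exact Nat.add_le_add_left (sum_le_sum_of_subset (range_subset_range.2 hi)) 1

variable {O : BlackBox F n} {P : ABP F n} {i X : ℕ} {σ : Store F}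

theorem runs_accumulate (h : P.AtLevel i σ) (hX : P.width (i + 1) ≤ X) {a : ℕ} {f g : FExp}
    (hfg : f.cost + g.cost ≤ 50) (φ : ℕ → F)
    (hφ : ∀ l < P.width (i + 1), ∀ τ, Same 9 {a} σ τ → τ.nvar 9 = l →
      f.eval τ * g.eval τ = φ l) :
    Runs O (accumulate a f g) σ (loopTime X 100) fun τ => Same 9 {a} σ τ ∧
      τ.farr a (0, 0, 0, 0) = σ.farr a (0, 0, 0, 0) - ∑ l ∈ range (P.width (i + 1)), φ l := by
  refine Runs.forLoop (M := P.width (i + 1)) (fun m τ => τ.nvar 9 = m ∧ Same 9 {a} σ τ ∧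
    τ.farr a (0, 0, 0, 0) = σ.farr a (0, 0, 0, 0) - ∑ l ∈ range m, φ l) ?_ hX ?_ ?_ ?_ ?_
  · simp [NExp.cost]
  · exact ⟨by simp, (Same.refl _ _ _).setVar le_rfl _, by simp⟩
  · rintro m τ ⟨h1, h2, -⟩
    exact ⟨h1, (h.of_same h2 (by omega)).eval_nextWidth⟩
  · rintro m hm τ ⟨h1, h2, h3⟩
    refine (Runs.setFArr ?_).mono (by simp only [NExp.cost, FExp.cost]; omega) fun _ => id
    refine ⟨by simp [h1], (h2.setFArr (by simp) _ _).setVar le_rfl _, ?_⟩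
    simp only [FExp.eval, NExp.eval, Store.setVar_farr, Store.setFArr_farr_self, if_true, h3,
      hφ m hm τ h2 h1, sum_range_succ]
    ring
  · rintro τ ⟨-, h2, h3⟩
    exact ⟨h2, h3⟩

theorem reduceRow_congr {o w k₀ : ℕ} {r r' b b' : ℕ → F} {R : F} {A A' : Index → F} {I : Index}
    (h : ∀ c d, A (I.1, I.2.1, c, d) = A' (I.1, I.2.1, c, d)) (hr : ∀ l < w, r l = r' l)
    (hb : ∀ l < w, b l = b' l) :
    reduceRow o w k₀ r b R A I = reduceRow o w k₀ r' b' R A' I := by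
  have hs : ∑ l ∈ range w, r l * A' (I.1, I.2.1, o + l, 0) =
      ∑ l ∈ range w, r' l * A' (I.1, I.2.1, o + l, 0) :=
    sum_congr rfl fun l hl => by rw [hr l (mem_range.1 hl)]
  simp only [reduceRow, h, hs]
  refine if_ctx_congr Iff.rfl (fun hc => ?_) fun _ => rfl
  rw [hb _ (by omega)]

/-- The multiplier of the row is computed before any entry changes, so the columns can be updated in
place: each loses its multiple, and finally the pivot column gains the multiplier once. -/
theorem runs_eliminateRow (h : P.AtLevel i σ) (hX : P.width (i + 1) ≤ X)
    (hk₀ : σ.nvar 6 < P.width (i + 1)) :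
    Runs O eliminateRow σ (rowTime X) fun τ => Same 9 {1, 4} σ τ ∧
      ∀ I : Index, τ.farr 1 I = if I.1 = σ.nvar 8 ∧ I.2.1 = P.offset i + σ.nvar 7 then
        reduceRow (P.offset (i + 1)) (P.width (i + 1)) (σ.nvar 6)
          (fun l => σ.farr 0 (i, σ.nvar 4, l, σ.nvar 5))
          (fun l => σ.farr 2 (1, P.offset (i + 1) + l, 0, 0)) (σ.farr 3 (0, 0, 0, 0))
          (σ.farr 1) I else σ.farr 1 I := by
  set D₁ := σ.farr 1 (σ.nvar 8, P.offset i + σ.nvar 7, 0, 0) - ∑ l ∈ range (P.width (i + 1)),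
    σ.farr 0 (i, σ.nvar 4, l, σ.nvar 5) *
      σ.farr 1 (σ.nvar 8, P.offset i + σ.nvar 7, P.offset (i + 1) + l, 0) with hD₁
  set D := D₁ * (σ.farr 3 (0, 0, 0, 0))⁻¹ with hD
  have hD₂ : ∀ τ, Same 9 {4} σ τ → P.AtLevel i τ := fun τ ht => h.of_same ht (by omega)
  refine ((Runs.setFArr (Q := fun τ => Same 9 {4} σ τ ∧ τ.farr 4 (0, 0, 0, 0) =
    σ.farr 1 (σ.nvar 8, P.offset i + σ.nvar 7, 0, 0)) ?_).seq (U := loopTime X 100 + loopTime X 100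
      + 300) ?_).mono ?_ fun _ => id
  · refine ⟨(Same.refl _ _ _).setFArr (by simp) _ _, ?_⟩
    simp [FExp.eval, NExp.eval, Store.setFArr_farr_self, h.var_three]
  rotate_left
  · simp only [rowTime, NExp.cost, FExp.cost]; omega
  rintro τ₁ ⟨hs₁, ht₁⟩
  refine ((runs_accumulate (hD₂ _ hs₁) hX (by simp [NExp.cost, FExp.cost])
    (fun l => σ.farr 0 (i, σ.nvar 4, l, σ.nvar 5) *
      σ.farr 1 (σ.nvar 8, P.offset i + σ.nvar 7, P.offset (i + 1) + l, 0)) ?_).seq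
      (U := loopTime X 100 + 200) ?_).mono (by omega) fun _ => id
  · intro l hl τ hs hl'
    have hs' := hs₁.trans hs
    have hL := hD₂ _ hs'
    simp only [FExp.eval]
    -- Only the outer node of the address is unfolded, so that `eval_nextOffset` still matches.
    rw [NExp.eval, NExp.eval.eq_def _ (add nextOffsetExp (var 9))]
    simp only [hL.eval_nextOffset]
    simp only [NExp.eval, hL.var_two, hL.var_three, hl', hs'.nvar 4 (by omega),
      hs'.nvar 5 (by omega), hs'.nvar 7 (by omega), hs'.nvar 8 (by omega),
      hs'.farr 0 (by simp), hs'.farr 1 (by simp)]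
  rintro τ₂ ⟨hs₂, ht₂⟩
  rw [ht₁, ← hD₁] at ht₂
  have hs₂ := hs₁.trans hs₂
  refine ((Runs.setFArr (Q := fun τ => Same 9 {4} σ τ ∧ τ.farr 4 (0, 0, 0, 0) = D) ?_).seq
    (U := loopTime X 100 + 100) ?_).mono ?_ fun _ => id
  · refine ⟨hs₂.setFArr (by simp) _ _, ?_⟩
    simp [FExp.eval, NExp.eval, Store.setFArr_farr_self, ht₂, hs₂.farr 3, hD]
  rotate_left
  · simp only [NExp.cost, FExp.cost]; omega
  rintro τ₃ ⟨hs₃, ht₃⟩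
  have hentry : ∀ τ, Same 9 {1, 4} σ τ → ∀ x, (entryExp x).eval τ =
      τ.farr 1 (σ.nvar 8, P.offset i + σ.nvar 7, P.offset (i + 1) + τ.nvar x, 0) := by
    intro τ hs x
    have hL := h.of_same hs (by omega)
    simp only [FExp.eval]
    rw [NExp.eval.eq_def _ (add nextOffsetExp (var x))]
    simp only [hL.eval_nextOffset]
    simp only [NExp.eval, hL.var_three, hs.nvar 7 (by omega), hs.nvar 8 (by omega)]
  refine ((Runs.forLoop (M := P.width (i + 1)) (T := 100) (X := X) (Q := fun τ =>
      (Same 9 {1, 4} σ τ ∧ τ.farr 4 (0, 0, 0, 0) = D ∧ ∀ I : Index, τ.farr 1 I =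
        if I.1 = σ.nvar 8 ∧ I.2.1 = P.offset i + σ.nvar 7 ∧ P.offset (i + 1) ≤ I.2.2.1 ∧
          I.2.2.1 < P.offset (i + 1) + P.width (i + 1) ∧ I.2.2.2 = 0 then
          σ.farr 1 I - σ.farr 2 (1, I.2.2.1, 0, 0) * D else σ.farr 1 I))
    (fun m τ => τ.nvar 9 = m ∧
      (Same 9 {1, 4} σ τ ∧ τ.farr 4 (0, 0, 0, 0) = D ∧ ∀ I : Index, τ.farr 1 I =
        if I.1 = σ.nvar 8 ∧ I.2.1 = P.offset i + σ.nvar 7 ∧ P.offset (i + 1) ≤ I.2.2.1 ∧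
          I.2.2.1 < P.offset (i + 1) + m ∧ I.2.2.2 = 0 then
          σ.farr 1 I - σ.farr 2 (1, I.2.2.1, 0, 0) * D else σ.farr 1 I))
    (by simp [NExp.cost]) hX ?_ ?_ ?_ ?_).seq (U := 50) ?_).mono (by omega) fun _ => id
  · refine ⟨by simp, (hs₃.mono le_rfl (by simp)).setVar le_rfl _, ht₃, fun I => ?_⟩
    rw [if_neg (by omega), Store.setVar_farr, hs₃.farr 1 (by simp)]
  · rintro m τ ⟨h1, h2, -⟩
    exact ⟨h1, (h.of_same h2 (by omega)).eval_nextWidth⟩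
  · rintro m hm τ ⟨h1, h2, h3, h4⟩
    refine (Runs.setFArr ?_).mono (by simp [NExp.cost, FExp.cost]) fun _ => id
    refine ⟨by simp [h1], (h2.setFArr (by simp) _ _).setVar le_rfl _, ?_, fun I => ?_⟩
    · rw [Store.setVar_farr, Store.setFArr_farr_of_ne _ _ _ (by omega), h3]
    · have hL := h.of_same h2 (by omega)
      rw [Store.setVar_farr, Store.setFArr_farr_self, FExp.eval, hentry _ h2, FExp.eval, FExp.eval,
        NExp.eval.eq_def _ (add nextOffsetExp (var 9))]
      simp only [hL.eval_nextOffset]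
      simp only [NExp.eval, FExp.eval, hL.var_three, h2.nvar 7 (by omega), h2.nvar 8 (by omega), h1,
        h2.farr 2 (by simp), h3]
      obtain ⟨I₁, I₂, I₃, I₄⟩ := I
      simp only [Prod.mk.injEq]
      by_cases hI : I₁ = σ.nvar 8 ∧ I₂ = P.offset i + σ.nvar 7 ∧ I₃ = P.offset (i + 1) + m ∧ I₄ = 0
      · obtain ⟨rfl, rfl, rfl, rfl⟩ := hI
        rw [if_pos ⟨rfl, rfl, rfl, rfl⟩, h4, if_neg (by dsimp only; omega),
          if_pos (by omega)]
      · rw [if_neg hI, h4]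
        congr 1
        dsimp only
        simp only [eq_iff_iff]
        omega
  · rintro τ ⟨-, h2⟩
    exact h2
  rintro τ₄ ⟨hs₄, ht₄, ha₄⟩
  refine (Runs.setFArr ?_).mono (by simp [NExp.cost, FExp.cost]) fun _ => id
  refine ⟨hs₄.setFArr (by simp) _ _, fun I => ?_⟩
  have hL := h.of_same hs₄ (by omega)
  rw [Store.setFArr_farr_self, FExp.eval, hentry _ hs₄,
    NExp.eval.eq_def _ (add nextOffsetExp (var 6))]
  simp only [hL.eval_nextOffset]
  simp only [NExp.eval, FExp.eval, hL.var_three, hs₄.nvar 6 (by omega), hs₄.nvar 7 (by omega),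
    hs₄.nvar 8 (by omega), ht₄]
  obtain ⟨I₁, I₂, I₃, I₄⟩ := I
  simp only [Prod.mk.injEq, ha₄, reduceRow]
  by_cases hI : I₁ = σ.nvar 8 ∧ I₂ = P.offset i + σ.nvar 7
  · obtain ⟨rfl, rfl⟩ := hI
    by_cases hI : P.offset (i + 1) ≤ I₃ ∧ I₃ < P.offset (i + 1) + P.width (i + 1) ∧ I₄ = 0
    · obtain ⟨h3, h4, rfl⟩ := hI
      by_cases h5 : I₃ = P.offset (i + 1) + σ.nvar 6
      · subst h5
        simp [hk₀, hD, hD₁]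
        ring
      · simp [h3, h4, h5, hD, hD₁]
        ring
    · rw [if_neg (by omega), if_neg (by tauto), if_pos (by tauto), if_neg hI]
  · rw [if_neg (by tauto), if_neg (by tauto), if_neg (by tauto)]

/-- The update of a row of one matrix reads matrix entries only from that same row. Hence treating
the rows successively in place equals the simultaneous update. -/
theorem runs_eliminateRows (h : P.AtLevel i σ) (hX : P.depth + P.size + n ≤ X)
    (hk₀ : σ.nvar 6 < P.width (i + 1)) :
    Runs O (forLoop 7 widthExp (forLoop 8 (var 0) eliminateRow)) σ
      (loopTime X (loopTime X (rowTime X))) fun τ => Same 7 {1, 4} σ τ ∧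
      τ.farr 1 = P.reduce i (σ.nvar 6)
          (fun l => σ.farr 0 (i, σ.nvar 4, l, σ.nvar 5))
          (fun l => σ.farr 2 (1, P.offset (i + 1) + l, 0, 0)) (σ.farr 3 (0, 0, 0, 0))
          (σ.farr 1) := by
  have hw := P.width_le_size h.lt.le
  have hw' : P.width (i + 1) ≤ P.size := P.width_le_size h.lt
  set A' := fun I => reduceRow (P.offset (i + 1)) (P.width (i + 1)) (σ.nvar 6)
    (fun l => σ.farr 0 (i, σ.nvar 4, l, σ.nvar 5))
    (fun l => σ.farr 2 (1, P.offset (i + 1) + l, 0, 0)) (σ.farr 3 (0, 0, 0, 0)) (σ.farr 1) I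
    with hA'
  refine Runs.forLoop (M := P.width i) (fun m τ => τ.nvar 7 = m ∧ Same 7 {1, 4} σ τ ∧
    ∀ I : Index, τ.farr 1 I = if I.1 < n ∧ P.offset i ≤ I.2.1 ∧ I.2.1 < P.offset i + m then A' I
      else σ.farr 1 I) (by simp [NExp.cost]) (by omega) ?_ ?_ ?_ ?_
  · refine ⟨by simp, (Same.refl _ _ _).setVar le_rfl _, fun I => ?_⟩
    rw [if_neg (by omega), Store.setVar_farr]
  · rintro m τ ⟨h1, h2, -⟩
    exact ⟨h1, (h.of_same h2 (by omega)).eval_width⟩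
  · rintro a ha τ₀ ⟨h1, hs₀, hτ₀⟩
    refine Runs.forLoop (M := n) (fun m τ => τ.nvar 8 = m ∧ τ.nvar 7 = a ∧ Same 7 {1, 4} σ τ ∧
      ∀ I : Index, τ.farr 1 I = if I.1 < n ∧ P.offset i ≤ I.2.1 ∧ I.2.1 < P.offset i + a ∨
        I.1 < m ∧ I.2.1 = P.offset i + a then A' I else σ.farr 1 I)
      (by simp [NExp.cost]) (by omega) ?_ ?_ ?_ ?_
    · refine ⟨by simp, ?_, hs₀.setVar (by omega) _, fun I => ?_⟩
      · rw [Store.setVar_nvar_of_ne _ _ (by omega), h1]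
      · rw [Store.setVar_farr, hτ₀]
        simp
    · rintro m τ ⟨h1, -, h2, -⟩
      exact ⟨h1, (h.of_same h2 (by omega)).var_zero⟩
    · rintro u hu τ ⟨h8, h7, hs, hτ⟩
      have h6 := hs.nvar 6 (by omega)
      refine (runs_eliminateRow (h.of_same hs (by omega)) (X := X) (by omega)
        (by rwa [h6])).mono le_rfl ?_
      rintro ρ ⟨hs', hρ⟩
      refine ⟨by simp [hs'.nvar 8, h8], ?_, (hs.trans (hs'.mono (by omega) subset_rfl)).setVar
        (by omega) _, fun I => ?_⟩
      · rw [Store.setVar_nvar_of_ne _ _ (by omega), hs'.nvar 7 (by omega), h7]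
      · rw [Store.setVar_farr, hρ, h8, h7, h6, hs.nvar 4 (by omega), hs.nvar 5 (by omega),
          hs.farr 0 (by simp), hs.farr 2 (by simp), hs.farr 3 (by simp)]
        by_cases hI : I.1 = u ∧ I.2.1 = P.offset i + a
        · rw [if_pos hI, if_pos (by omega)]
          -- The row about to be treated still has its original entries.
          refine reduceRow_congr (fun c d => ?_) (fun _ _ => rfl) fun _ _ => rfl
          rw [hτ, if_neg]
          dsimp only
          omega
        · rw [if_neg hI, hτ]
          refine if_congr ?_ rfl rfl
          omega
    · rintro τ ⟨-, h7, hs, hτ⟩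
      refine ⟨by simp [h7], hs.setVar (by omega) _, fun I => ?_⟩
      rw [Store.setVar_farr, hτ]
      refine if_congr ?_ rfl rfl
      omega
  · rintro τ ⟨-, hs, hτ⟩
    exact ⟨hs, funext fun I => by rw [hτ, reduce]⟩

theorem runs_evaluate (h : P.AtLevel i σ) (hX : P.depth + P.size + n ≤ X) {x : ℕ}
    (hx : σ.nvar x < P.width (i + 1)) :
    Runs P.blackBox (evaluate x) σ (queryTime X) fun τ => τ.nvar = σ.nvar ∧ Same 10 {2} σ τ ∧
      ∀ b < P.offset (i + 2),
        τ.farr 2 (1, b, 0, 0) = P.rowVec (σ.farr 1) (P.offset (i + 2)) (i + 1) (σ.nvar x) b := by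
  -- The dimension covers node 0 and all nodes up to level `i + 1`; it must exceed 1 because row 1
  -- of the answer is read.
  have hN : 1 < P.offset (i + 2) := by
    have h1 := P.offset_succ i
    have h2 := P.offset_succ (i + 1)
    have h3 := P.offset_pos i
    simp only [add_assoc, Nat.reduceAdd] at h2
    omega
  have hlt := h.lt
  have hle : P.offset (i + 2) ≤ X + 1 := (P.offset_le_size (by omega)).trans (by omega)
  refine (Runs.query (k := P.offset (i + 2)) (B := FreeAlgebra.lift F (σ.readMatrices 1 n
    (P.offset (i + 2))) (P.gatePoly (i + 1) (σ.nvar x))) ?_ ?_ ?_).mono ?_ fun _ => id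
  · rw [NExp.eval, h.eval_nextOffset, h.eval_nextWidth, ← offset_succ]
  · simp only [blackBox, NExp.eval, h.var_two]
    rw [if_pos ⟨by omega, hx⟩]
  · refine ⟨rfl, ⟨rfl, fun _ _ => rfl, fun a ha => ?_⟩, fun b hb => ?_⟩
    · exact Function.update_of_ne (by simpa using ha) ..
    · simp only [Store.writeMatrix, Function.update_self]
      rw [dif_pos ⟨hN, hb, trivial⟩]
      exact P.lift_gatePoly (σ.farr 1) hN (i + 1) (σ.nvar x) ⟨b, hb⟩
  · have h1 : (n + 1) * P.offset (i + 2) ^ 2 ≤ (X + 1) * (X + 1) ^ 2 :=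
      Nat.mul_le_mul (by omega) (Nat.pow_le_pow_left hle 2)
    simp only [queryTime, NExp.cost]
    omega

/-- The column of the temporary node stands for the functional of the gate `(i, k)` followed by
the variable `v`. -/
def TempIs (P : ABP F n) (A : Index → F) (i k : ℕ) (v : Fin n) : Prop :=
  ∀ (u : Fin n) a, A (u, a, 0, 0) = if u = v ∧ a = P.offset i + k then 1 else 0

/-- One query at the pivot gate suffices: column 0 of the answer gives the value of the functional
being treated, and the columns of level `i + 1` give the values of the current `φ' l`. The weights
`r` are the labels already stored. -/
theorem runs_eliminate {k : ℕ} {v : Fin n} (h : P.AtLevel i σ) (hX : P.depth + P.size + n ≤ X)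
    (hk₀ : σ.nvar 6 < P.width (i + 1)) (h4 : σ.nvar 4 = k) (hk : k < P.width i)
    (h5 : σ.nvar 5 = v) (hA : P.Supported (σ.farr 1)) (hT : P.TempIs (σ.farr 1) i k v)
    (hl : ∀ l < P.width (i + 1), σ.farr 0 (i, k, l, v) = P.extend (σ.farr 1) i k v l) :
    Runs P.blackBox eliminate σ (eliminateTime X) fun τ => Same 7 {1, 2, 3, 4} σ τ ∧
      τ.farr 1 = P.reduce i (σ.nvar 6) (P.extend (σ.farr 1) i k v)
        (P.probe (σ.farr 1) (i + 1) (σ.nvar 6))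
        (P.residual (σ.farr 1) i (P.extend (σ.farr 1) i k v) (σ.nvar 6)) (σ.farr 1) := by
  have hw' : P.width (i + 1) ≤ P.size := P.width_le_size h.lt
  have hN := P.offset_succ (i + 1)
  have hN' := P.offset_succ i
  simp only [add_assoc, Nat.reduceAdd] at hN
  refine ((runs_evaluate h hX hk₀).seq (U := loopTime X 100 + loopTime X (loopTime X (rowTime X)) +
    150) ?_).mono ?_ fun _ => id
  rotate_left
  · simp only [eliminateTime]; omega
  rintro τ₁ ⟨hn₁, hs₁, hτ₁⟩
  refine ((Runs.setFArr (Q := fun τ => τ.nvar = σ.nvar ∧ Same 10 {2, 3} σ τ ∧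
    τ.farr 2 = τ₁.farr 2 ∧
    τ.farr 3 (0, 0, 0, 0) = P.extend (σ.farr 1) i k v (σ.nvar 6)) ?_).seq
    (U := loopTime X 100 + loopTime X (loopTime X (rowTime X)) + 50) ?_).mono ?_ fun _ => id
  · refine ⟨hn₁, (hs₁.mono le_rfl (by simp)).setFArr (by simp) _ _, ?_, ?_⟩
    · exact Store.setFArr_farr_of_ne _ _ _ (by omega)
    · simp only [Store.setFArr_farr_self, NExp.eval, FExp.eval, if_true]
      rw [hτ₁ 0 (P.offset_pos _), P.rowVec_temp hA hT _ (P.offset_mono (by omega)) hk]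
  rotate_left
  · simp only [NExp.cost, FExp.cost]; omega
  rintro τ₂ ⟨hn₂, hs₂, he₂, hτ₂⟩
  have hb : ∀ l < P.width (i + 1), τ₁.farr 2 (1, P.offset (i + 1) + l, 0, 0) =
      P.probe (σ.farr 1) (i + 1) (σ.nvar 6) l := fun l hl => by
    rw [hτ₁ _ (by omega), P.rowVec_node hA _ le_rfl hl]
  refine ((runs_accumulate (X := X) (h.of_same hs₂ (by omega)) (by omega)
    (by simp [NExp.cost, FExp.cost])
    (fun l => P.extend (σ.farr 1) i k v l * P.probe (σ.farr 1) (i + 1) (σ.nvar 6) l) ?_).seq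
      (U := loopTime X (loopTime X (rowTime X))) ?_).mono (by omega) fun _ => id
  · intro l hl' τ hs h9
    have hs' := (hs₂.mono (c' := 9) (by omega) subset_rfl).trans (hs.mono le_rfl (by simp))
    have hL := h.of_same hs' (by omega)
    simp only [FExp.eval]
    rw [NExp.eval.eq_def _ (add nextOffsetExp (var 9))]
    simp only [hL.eval_nextOffset]
    simp only [NExp.eval, hL.var_two, h9, hs'.nvar 4 (by omega), hs'.nvar 5 (by omega),
      hs'.farr 0 (by simp), hs.farr 2 (by simp), h4, h5, hl l hl', he₂, hb l hl']
  rintro τ₃ ⟨hs₃, hτ₃⟩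
  have hs : Same 9 {2, 3} σ τ₃ :=
    (hs₂.mono (by omega) subset_rfl).trans (hs₃.mono le_rfl (by simp))
  have h6 := hs.nvar 6 (by omega)
  refine (runs_eliminateRows (h.of_same hs (by omega)) hX (by rwa [h6])).mono le_rfl ?_
  rintro τ ⟨hs₄, hτ⟩
  refine ⟨(hs.mono (by omega) (by decide)).trans (hs₄.mono le_rfl (by decide)), ?_⟩
  rw [hτ]
  funext I
  simp only [reduce]
  refine if_congr Iff.rfl ?_ (by rw [hs.farr 1 (by simp)])
  rw [hτ₃, hτ₂, h6, ← residual]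
  refine reduceRow_congr (fun c d => by rw [hs.farr 1 (by simp)]) (fun l hl' => ?_) fun l hl' => ?_
  · rw [hs.nvar 4 (by omega), hs.nvar 5 (by omega), hs.farr 0 (by simp), h4, h5, hl l hl']
  · rw [hs₃.farr 2 (by simp), he₂, hb l hl']

/-- By `rowVec_temp`, column 0 of the answer at each gate is the label sought. The same numbers
later serve as weights in the elimination. -/
theorem runs_computeLabels {k : ℕ} {v : Fin n} (h : P.AtLevel i σ)
    (hX : P.depth + P.size + n ≤ X) (h4 : σ.nvar 4 = k) (hk : k < P.width i)
    (h5 : σ.nvar 5 = v) (hA : P.Supported (σ.farr 1)) (hT : P.TempIs (σ.farr 1) i k v) :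
    Runs P.blackBox computeLabels σ (loopTime X (queryTime X + 100)) fun τ =>
      Same 9 {0, 2} σ τ ∧ ∀ I : Index, τ.farr 0 I =
        if I.1 = i ∧ I.2.1 = k ∧ I.2.2.1 < P.width (i + 1) ∧ I.2.2.2 = v then
          P.extend (σ.farr 1) i k v I.2.2.1 else σ.farr 0 I := by
  have hw' : P.width (i + 1) ≤ P.size := P.width_le_size h.lt
  refine Runs.forLoop (M := P.width (i + 1)) (fun m τ => τ.nvar 9 = m ∧ Same 9 {0, 2} σ τ ∧
    ∀ I : Index, τ.farr 0 I = if I.1 = i ∧ I.2.1 = k ∧ I.2.2.1 < m ∧ I.2.2.2 = v then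
      P.extend (σ.farr 1) i k v I.2.2.1 else σ.farr 0 I) (by simp [NExp.cost]) (by omega) ?_ ?_ ?_ ?_
  · exact ⟨by simp, (Same.refl _ _ _).setVar le_rfl _, by simp⟩
  · rintro m τ ⟨h1, h2, -⟩
    exact ⟨h1, (h.of_same h2 (by omega)).eval_nextWidth⟩
  · rintro m hm τ ⟨h9, hs, hτ⟩
    have hL := h.of_same hs (by omega)
    refine ((runs_evaluate hL hX (x := 9) (by omega)).seq (U := 50) ?_).mono (by omega)
      fun _ => id
    rintro ρ ⟨hn, hs', hρ⟩
    have hL' := hL.of_same hs' (by omega)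
    refine (Runs.setFArr ?_).mono (by simp [NExp.cost, FExp.cost]) fun _ => id
    have hs'' := hs.trans (hs'.mono (c' := 9) (by omega) (by decide : _ ⊆ ({0, 2} : Finset ℕ)))
    refine ⟨by simp [hn, h9], (hs''.setFArr (by simp) _ _).setVar le_rfl _, fun I => ?_⟩
    simp only [Store.setVar_farr, Store.setFArr_farr_self, NExp.eval, FExp.eval, hL'.var_two,
      hs''.nvar 4 (by omega), hs''.nvar 5 (by omega), h4, h5, hn, h9, hs'.farr 0 (by simp), hτ]
    rw [hρ 0 (P.offset_pos _), hs.farr 1 (by simp),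
      P.rowVec_temp hA hT _ (P.offset_mono (by omega)) hk, h9]
    obtain ⟨I₁, I₂, I₃, I₄⟩ := I
    simp only [Prod.mk.injEq]
    by_cases hI : I₁ = i ∧ I₂ = k ∧ I₃ = m ∧ I₄ = v
    · obtain ⟨rfl, rfl, rfl, rfl⟩ := hI
      simp
    · rw [if_neg hI]
      refine if_congr ?_ rfl rfl
      omega
  · rintro τ ⟨-, hs, hτ⟩
    exact ⟨hs, hτ⟩

theorem Supported.congr {A A' : Index → F} (hA : P.Supported A)
    (h : ∀ v a b, b ≠ 0 → A' (v, a, b, 0) = A (v, a, b, 0)) : P.Supported A' := by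
  intro v i a l hl ha
  rw [h _ _ _ (by have := P.offset_pos (i + 1); omega), hA v i a l hl ha]

theorem probe_congr_of_ne_zero {A A' : Index → F}
    (h : ∀ v a b, b ≠ 0 → A' (v, a, b, 0) = A (v, a, b, 0)) (i j : ℕ) {k : ℕ}
    (hk : k < P.width i) : P.probe A' i j k = P.probe A i j k :=
  P.probe_congr (fun v i' a l _ _ =>
    h _ _ _ (by have := P.offset_pos (i' + 1); omega)) j hk

theorem extend_eq_of_probe {A A' : Index → F} {k : ℕ}
    (h : ∀ j, P.probe A' i j k = P.probe A i j k) (v : Fin n) :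
    P.extend A' i k v = P.extend A i k v :=
  funext fun j => sum_congr rfl fun j₁ _ => by rw [h]

theorem residual_eq_of_probe {A A' : Index → F}
    (h : ∀ j, ∀ l < P.width (i + 1), P.probe A' (i + 1) j l = P.probe A (i + 1) j l)
    (x : ℕ → F) (j : ℕ) : P.residual A' i x j = P.residual A i x j := by
  rw [residual, residual, sum_congr rfl fun l hl => by rw [h j l (mem_range.1 hl)]]

/-! ### Progress through the functionals of one level. -/

/-- The matrices `A'` are obtained from `A` by eliminations in level `i + 1`, which do not affect
the functionals of level `i` and preserve what has been achieved. -/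
structure Improves (P : ABP F n) (i : ℕ) (A A' : Index → F) : Prop where
  probe : ∀ j, ∀ k < P.width i, P.probe A' i j k = P.probe A i j k
  residual : ∀ x : ℕ → F, (∀ j < P.width (i + 1), P.residual A i x j = 0) →
    ∀ j < P.width (i + 1), P.residual A' i x j = 0

theorem Improves.refl (P : ABP F n) (i : ℕ) (A : Index → F) : P.Improves i A A :=
  ⟨fun _ _ _ => rfl, fun _ h => h⟩

theorem Improves.trans {A A' A'' : Index → F} (h : P.Improves i A A') (h' : P.Improves i A' A'') :
    P.Improves i A A'' :=
  ⟨fun j k hk => (h'.probe j k hk).trans (h.probe j k hk),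
    fun x hx => h'.residual x (h.residual x hx)⟩

/-- No `probe` reads column 0, since nodes of gates have positive numbers. So setting and erasing
the temporary column is harmless. -/
theorem Improves.of_ne_zero {A A' : Index → F}
    (h : ∀ v a b, b ≠ 0 → A' (v, a, b, 0) = A (v, a, b, 0)) : P.Improves i A A' :=
  ⟨fun j _ hk => probe_congr_of_ne_zero h i j hk, fun x hx j hj => by
    rw [residual_eq_of_probe (fun j l hl => probe_congr_of_ne_zero h (i + 1) j hl), hx j hj]⟩

theorem Improves.extend {A A' : Index → F} (h : P.Improves i A A') {k : ℕ} (hk : k < P.width i)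
    (v : Fin n) : P.extend A' i k v = P.extend A i k v :=
  extend_eq_of_probe (fun j => h.probe j k hk) v

/-- By `residual_reduce` a new residual is a combination of the old residuals of the same `x` at `j`
and `k₀`. This holds for every `R`, even a zero pivot. -/
theorem Improves.reduce {A : Index → F} {k : ℕ} {v : Fin n} (hT : P.TempIs A i k v)
    (hk : k < P.width i) {k₀ : ℕ} (hk₀ : k₀ < P.width (i + 1)) (R : F) :
    P.Improves i A (P.reduce i k₀ (P.extend A i k v) (P.probe A (i + 1) k₀) R A) where
  probe j k' hk' := P.probe_reduce_of_le le_rfl _ _ _ _ _ _ hk'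
  residual x hx j hj := by
    rw [P.residual_reduce hT hk hk₀ _ _ _ (fun _ => rfl) fun _ _ => rfl, hx j hj, hx k₀ hk₀]
    simp

/-- A nonzero pivot value makes the residual vanish everywhere. A zero one means that it vanishes at
this gate already, and since `0⁻¹ = 0` the step then changes nothing. Trying every gate as pivot
therefore needs no zero test. -/
theorem runs_eliminations {k : ℕ} {v : Fin n} (h : P.AtLevel i σ)
    (hX : P.depth + P.size + n ≤ X) (h4 : σ.nvar 4 = k) (hk : k < P.width i)
    (h5 : σ.nvar 5 = v) (hA : P.Supported (σ.farr 1)) (hT : P.TempIs (σ.farr 1) i k v)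
    (hl : ∀ l < P.width (i + 1), σ.farr 0 (i, k, l, v) = P.extend (σ.farr 1) i k v l) :
    Runs P.blackBox (forLoop 6 nextWidthExp eliminate) σ (loopTime X (eliminateTime X)) fun τ =>
      Same 6 {1, 2, 3, 4} σ τ ∧ P.Supported (τ.farr 1) ∧ P.TempIs (τ.farr 1) i k v ∧
      P.Improves i (σ.farr 1) (τ.farr 1) ∧
      ∀ j < P.width (i + 1), P.residual (τ.farr 1) i (P.extend (σ.farr 1) i k v) j = 0 := by
  have hw' : P.width (i + 1) ≤ P.size := P.width_le_size h.lt
  refine Runs.forLoop (M := P.width (i + 1)) (fun m τ => τ.nvar 6 = m ∧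
      Same 6 {1, 2, 3, 4} σ τ ∧ P.Supported (τ.farr 1) ∧ P.TempIs (τ.farr 1) i k v ∧
      P.Improves i (σ.farr 1) (τ.farr 1) ∧
      ∀ j < m, P.residual (τ.farr 1) i (P.extend (σ.farr 1) i k v) j = 0)
      (by simp [NExp.cost]) (by omega) ?_ ?_ ?_ ?_
  · exact ⟨by simp, (Same.refl _ _ _).setVar le_rfl _, hA, hT, Improves.refl _ _ _, by simp⟩
  · rintro m τ ⟨h1, h2, -⟩
    exact ⟨h1, (h.of_same h2 (by omega)).eval_nextWidth⟩
  · rintro m hm τ ⟨h6, hs, hA₁, hT₁, hI, hR⟩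
    have he := hI.extend hk v
    refine (runs_eliminate (h.of_same hs (by omega)) hX (by rwa [h6])
      ((hs.nvar 4 (by omega)).trans h4) hk ((hs.nvar 5 (by omega)).trans h5) hA₁ hT₁
      (fun l hl' => by rw [hs.farr 0 (by simp), hl l hl', he])).mono le_rfl ?_
    rintro ρ ⟨hs', hρ⟩
    rw [h6] at hρ
    refine ⟨by simp [hs'.nvar 6, h6],
      (hs.trans (hs'.mono (by omega) subset_rfl)).setVar le_rfl _, ?_, ?_, ?_, fun j hj => ?_⟩
    all_goals rw [Store.setVar_farr, hρ]
    · exact hA₁.reduce _ _ _ _ _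
    · intro u a
      rw [P.reduce_of_lt _ _ _ _ _ _ (P.offset_pos _)]
      exact hT₁ u a
    · exact hI.trans (Improves.reduce hT₁ hk hm _)
    · rw [← he, P.residual_reduce hT₁ hk hm _ _ _ (fun _ => rfl) fun _ _ => rfl]
      rcases Nat.lt_succ_iff_lt_or_eq.1 hj with hj | rfl
      -- At an earlier gate the old residual is a factor of the correction too, so the zero
      -- persists.
      · rw [he, hR j hj]; simp
      · rw [mul_comm, mul_assoc]
        by_cases h0 : P.residual (τ.farr 1) i (P.extend (τ.farr 1) i k v) j = 0
        · simp [h0]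
        · rw [inv_mul_cancel₀ h0, mul_one, sub_self]
  · rintro τ ⟨-, hs, hA₁, hT₁, hI, hR⟩
    exact ⟨hs, hA₁, hT₁, hI, hR⟩

/-- The column of the temporary node is zero. -/
def TempZero (A : Index → F) (n : ℕ) : Prop := ∀ (u : Fin n) a, A (u, a, 0, 0) = 0

/-- In the treatment of level `i`, started with the matrices `A`, the functionals in `D` have been
processed. -/
structure Progress (P : ABP F n) (i : ℕ) (σ : Store F) (D : ℕ → Fin n → Prop) (τ : Store F) :
    Prop where
  same : Same 4 {0, 1, 2, 3, 4} σ τ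
  supported : P.Supported (τ.farr 1)
  temp : TempZero (τ.farr 1) n
  improves : P.Improves i (σ.farr 1) (τ.farr 1)
  residual : ∀ k < P.width i, ∀ v, D k v → ∀ j < P.width (i + 1),
    P.residual (τ.farr 1) i (P.extend (σ.farr 1) i k v) j = 0
  label : ∀ k < P.width i, ∀ v : Fin n, D k v → ∀ j < P.width (i + 1),
    τ.farr 0 (i, k, j, v) = P.extend (σ.farr 1) i k v j
  other : ∀ I : Index, I.1 ≠ i → τ.farr 0 I = σ.farr 0 I

theorem Progress.setVar {D : ℕ → Fin n → Prop} {τ : Store F} (h : P.Progress i σ D τ) {x : ℕ}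
    (hx : 4 ≤ x) (m : ℕ) : P.Progress i σ D (τ.setVar x m) :=
  ⟨h.same.setVar hx m, h.supported, h.temp, h.improves, h.residual, h.label, h.other⟩

theorem Progress.congr {D D' : ℕ → Fin n → Prop} {τ : Store F} (h : P.Progress i σ D τ)
    (hD : ∀ k v, k < P.width i → D' k v → D k v) : P.Progress i σ D' τ :=
  ⟨h.same, h.supported, h.temp, h.improves,
    fun k hk v hv => h.residual k hk v (hD k v hk hv),
    fun k hk v hv => h.label k hk v (hD k v hk hv), h.other⟩

/-- The functional `extend` is taken with respect to the matrices at the start of the level;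
`Improves.extend` says that the current matrices define the same one. Residuals of functionals
treated before stay zero by `Improves`. -/
theorem runs_processFunctional {k : ℕ} {v : Fin n} (h : P.AtLevel i σ)
    (hX : P.depth + P.size + n ≤ X) {D : ℕ → Fin n → Prop} {τ : Store F}
    (hP : P.Progress i σ D τ) (h4 : τ.nvar 4 = k) (hk : k < P.width i) (h5 : τ.nvar 5 = v) :
    Runs P.blackBox processFunctional τ (functionalTime X) fun ρ =>
      (∀ x < 6, ρ.nvar x = τ.nvar x) ∧
      P.Progress i σ (fun k' v' => D k' v' ∨ k' = k ∧ v' = v) ρ := by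
  have hL := h.of_same hP.same le_rfl
  refine ((Runs.setFArr (Q := fun ρ => Same 10 {1} τ ρ ∧ ∀ I : Index, ρ.farr 1 I =
    if I = (v.1, P.offset i + k, 0, 0) then 1 else τ.farr 1 I) ?_).seq
    (U := loopTime X (queryTime X + 100) + loopTime X (eliminateTime X) + 100) ?_).mono ?_
      fun _ => id
  · refine ⟨(Same.refl _ _ _).setFArr (by simp) _ _, fun I => ?_⟩
    rw [Store.setFArr_farr_self]
    simp only [NExp.eval, FExp.eval, hL.var_three, h4, h5]
  rotate_left
  · simp only [functionalTime, NExp.cost, FExp.cost]; omega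
  rintro τ₁ ⟨hs₁, hτ₁⟩
  have hne₁ : ∀ v a b, b ≠ 0 → τ₁.farr 1 (v, a, b, 0) = τ.farr 1 (v, a, b, 0) := by
    intro v a b hb
    rw [hτ₁, if_neg]
    simp [hb]
  have hA₁ := hP.supported.congr hne₁
  have hI₁ : P.Improves i (τ.farr 1) (τ₁.farr 1) := .of_ne_zero hne₁
  have hT₁ : P.TempIs (τ₁.farr 1) i k v := by
    intro u a
    rw [hτ₁, hP.temp u a]
    simp [Fin.ext_iff]
  have he₁ := (hP.improves.trans hI₁).extend hk v
  have h4₁ : τ₁.nvar 4 = k := (hs₁.nvar 4 (by omega)).trans h4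
  have h5₁ : τ₁.nvar 5 = v := (hs₁.nvar 5 (by omega)).trans h5
  refine ((runs_computeLabels (hL.of_same hs₁ (by omega)) hX h4₁ hk h5₁ hA₁ hT₁).seq
    (U := loopTime X (eliminateTime X) + 50) ?_).mono (by omega) fun _ => id
  rintro τ₂ ⟨hs₂, hτ₂⟩
  have hs₂' : Same 9 {0, 1, 2} τ τ₂ :=
    (hs₁.mono (by omega) (by decide)).trans (hs₂.mono le_rfl (by decide))
  have h12 := hs₂.farr 1 (by simp)
  refine ((runs_eliminations (hL.of_same hs₂' (by omega)) hX ((hs₂.nvar 4 (by omega)).trans h4₁) hk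
    ((hs₂.nvar 5 (by omega)).trans h5₁) (h12 ▸ hA₁) (h12 ▸ hT₁) ?_).seq (U := 20) ?_).mono
    (by omega) fun _ => id
  · intro l hl
    rw [hτ₂, if_pos ⟨rfl, rfl, hl, rfl⟩, h12]
  rw [h12]
  rintro τ₃ ⟨hs₃, hA₃, hT₃, hI₃, hR₃⟩
  have hs₃' : Same 6 {0, 1, 2, 3, 4} τ τ₃ :=
    (hs₂'.mono (by omega) (by decide)).trans (hs₃.mono le_rfl (by decide))
  refine (Runs.setFArr ?_).mono (by simp [NExp.cost, FExp.cost]) fun _ => id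
  set ρ := Store.setFArr τ₃ 1 _ _ with hρ
  have hL₃ := hL.of_same hs₃' (by omega)
  have hs₄ : Same 6 {0, 1, 2, 3, 4} τ ρ := hs₃'.setFArr (by simp) _ _
  have hρ₁ : ∀ I : Index, ρ.farr 1 I =
      if I = (v.1, P.offset i + k, 0, 0) then 0 else τ₃.farr 1 I := by
    intro I
    rw [hρ, Store.setFArr_farr_self]
    simp only [NExp.eval, FExp.eval, hL₃.var_three, hs₃'.nvar 4 (by omega),
      hs₃'.nvar 5 (by omega), h4, h5]
  have hne₄ : ∀ v a b, b ≠ 0 → ρ.farr 1 (v, a, b, 0) = τ₃.farr 1 (v, a, b, 0) := by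
    intro v a b hb
    rw [hρ₁, if_neg]
    simp [hb]
  have hI₄ : P.Improves i (τ₃.farr 1) (ρ.farr 1) := .of_ne_zero hne₄
  have hI : P.Improves i (τ.farr 1) (ρ.farr 1) := (hI₁.trans hI₃).trans hI₄
  have hρ₀ : ∀ I : Index, ρ.farr 0 I = if I.1 = i ∧ I.2.1 = k ∧ I.2.2.1 < P.width (i + 1) ∧
      I.2.2.2 = v then P.extend (σ.farr 1) i k v I.2.2.1 else τ.farr 0 I := by
    intro I
    rw [hρ, Store.setFArr_farr_of_ne _ _ _ (by omega), hs₃.farr 0 (by simp), hτ₂, he₁,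
      hs₁.farr 0 (by simp)]
  refine ⟨hs₄.nvar, hP.same.trans (hs₄.mono (by omega) subset_rfl), hA₃.congr hne₄, ?_,
    hP.improves.trans hI, ?_, ?_, ?_⟩
  · intro u a
    rw [hρ₁, hT₃ u a]
    simp [Fin.ext_iff]
  · rintro k' hk' v' (hD | ⟨rfl, rfl⟩) j hj
    · exact hI.residual _ (hP.residual k' hk' v' hD) j hj
    · rw [he₁] at hR₃
      exact hI₄.residual _ hR₃ j hj
  · rintro k' hk' v' hD j hj
    rw [hρ₀]
    by_cases hc : k' = k ∧ v' = v
    · obtain ⟨rfl, rfl⟩ := hc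
      simp [hj]
    · rw [if_neg (fun hcc => hc ⟨hcc.2.1, Fin.ext hcc.2.2.2⟩)]
      exact hP.label k' hk' v' (hD.resolve_right hc) j hj
  · intro I hI
    rw [hρ₀, if_neg (fun hc => hI hc.1), hP.other I hI]

theorem runs_processLevel (h : P.AtLevel i σ) (hX : P.depth + P.size + n ≤ X)
    (hA : P.Supported (σ.farr 1)) (hT : TempZero (σ.farr 1) n) :
    Runs P.blackBox processLevel σ (levelTime X) fun τ => ∃ ρ, τ = ρ.setVar 3 (P.offset (i + 1)) ∧
      P.Progress i σ (fun _ _ => True) ρ := by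
  have hw := P.width_le_size h.lt.le
  refine ((Runs.forLoop (X := X) (T := loopTime X (functionalTime X)) (M := P.width i)
    (Q := P.Progress i σ (fun _ _ => True))
    (fun m τ => τ.nvar 4 = m ∧ P.Progress i σ (fun k _ => k < m) τ) (by simp [NExp.cost])
    (by omega) ?_ ?_ ?_ ?_).seq (U := 50) ?_).mono (by simp only [levelTime]; omega) fun _ => id
  · exact ⟨by simp, (Same.refl _ _ _).setVar le_rfl _, hA, hT, Improves.refl _ _ _, by simp,
      by simp, fun _ _ => rfl⟩
  · rintro m τ ⟨h1, h2⟩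
    exact ⟨h1, (h.of_same h2.same le_rfl).eval_width⟩
  · rintro k hk τ ⟨h4, hP⟩
    refine Runs.forLoop (M := n) (fun m τ => τ.nvar 5 = m ∧ τ.nvar 4 = k ∧
      P.Progress i σ (fun k' v' => k' < k ∨ k' = k ∧ v'.1 < m) τ) (by simp [NExp.cost])
      (by omega) ?_ ?_ ?_ ?_
    · refine ⟨by simp, ?_, (hP.congr ?_).setVar (by omega) _⟩
      · rw [Store.setVar_nvar_of_ne _ _ (by omega), h4]
      · intro k' v' _ h; omega
    · rintro m τ ⟨h1, -, h2⟩
      exact ⟨h1, (h.of_same h2.same le_rfl).var_zero⟩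
    · rintro m hm τ ⟨h5, h4, hP⟩
      refine (runs_processFunctional (v := ⟨m, hm⟩) h hX hP h4 hk h5).mono le_rfl ?_
      rintro ρ ⟨hn, hP'⟩
      refine ⟨by simp [hn, h5], ?_, (hP'.congr ?_).setVar (by omega) _⟩
      · rw [Store.setVar_nvar_of_ne _ _ (by omega), hn 4 (by omega), h4]
      · intro k' v' _ h
        simp only [Fin.ext_iff]
        omega
    · rintro τ ⟨-, h4, hP⟩
      refine ⟨by simp [h4], (hP.congr ?_).setVar le_rfl _⟩
      intro k' v' _ h
      have := v'.2
      omega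
  · rintro τ ⟨-, hP⟩
    exact hP.congr fun k v hk _ => hk
  · intro ρ hρ
    refine (Runs.setVar ⟨ρ, ?_, hρ⟩).mono (by simp [NExp.cost]) fun _ => id
    rw [(h.of_same hρ.same le_rfl).eval_nextOffset]

/-! ### Induction over the levels and the main theorem. -/

/-- The labels of the levels below `i` have been found. -/
def LabelsCorrect (P : ABP F n) (i : ℕ) (σ : Store F) : Prop :=
  ∀ i' < i, ∀ j < P.width (i' + 1), P.gatePoly (i' + 1) j = ∑ k ∈ range (P.width i'),
    P.gatePoly i' k * ∑ v : Fin n, σ.farr 0 (i', k, j, v) • FreeAlgebra.ι F v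

/-- The loop invariant combines duality in the current level with correct labels below it. The
former justifies the labels of the next level, and the vanishing residuals pass it on. -/
theorem runs_reconstruct (P : ABP F n) (hX : P.depth + P.size + n ≤ X) :
    Runs P.blackBox reconstruct (initial P) (totalTime X) fun τ =>
      τ.nvar 1 = P.depth ∧ (∀ m ≤ P.depth, τ.narr 0 (m, 0, 0, 0) = P.width m) ∧
      P.LabelsCorrect P.depth τ := by
  refine ((Runs.setVar (Q := fun τ => τ = (initial P).setVar 3 1) rfl).seq
    (U := loopTime X (levelTime X)) ?_).mono ?_ fun _ => id
  rotate_left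
  · simp only [totalTime, NExp.cost]; omega
  rintro τ₀ rfl
  refine Runs.forLoop (M := P.depth) (fun m τ => τ.nvar 2 = m ∧ τ.nvar 3 = P.offset m ∧
    τ.nvar 0 = n ∧ τ.nvar 1 = P.depth ∧ (∀ m ≤ P.depth, τ.narr 0 (m, 0, 0, 0) = P.width m) ∧
    P.Supported (τ.farr 1) ∧ TempZero (τ.farr 1) n ∧ P.Dual (τ.farr 1) m ∧ P.LabelsCorrect m τ)
    (by simp [NExp.cost]) (by omega) ?_ ?_ ?_ ?_
  · refine ⟨by simp, ?_, ?_, ?_, ?_, ?_, ?_, P.dual_zero _, by simp [LabelsCorrect]⟩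
    · rw [Store.setVar_nvar_of_ne _ _ (by omega), Store.setVar_nvar_self, offset_zero]
    · rw [Store.setVar_nvar_of_ne _ _ (by omega), Store.setVar_nvar_of_ne _ _ (by omega)]
      simp [initial]
    · rw [Store.setVar_nvar_of_ne _ _ (by omega), Store.setVar_nvar_of_ne _ _ (by omega)]
      simp [initial]
    · intro m hm
      simp [initial, hm]
    · intro v i a l _ _
      rfl
    · intro u a
      rfl
  · rintro m τ ⟨h2, -, -, h1, -⟩
    exact ⟨h2, h1⟩
  · rintro i hi τ ⟨h2, h3, h0, h1, hw, hA, hT, hD, hC⟩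
    have hL : P.AtLevel i τ := ⟨hi, h0, h2, h3, hw⟩
    refine (runs_processLevel hL hX hA hT).mono le_rfl ?_
    rintro _ ⟨ρ, rfl, hP⟩
    have hn := hP.same.nvar
    refine ⟨?_, ?_, ?_, ?_, ?_, hP.supported, hP.temp, ?_, ?_⟩
    · rw [Store.setVar_nvar_self, Store.setVar_nvar_of_ne _ _ (by omega), hn 2 (by omega), h2]
    · rw [Store.setVar_nvar_of_ne _ _ (by omega), Store.setVar_nvar_self]
    · rw [Store.setVar_nvar_of_ne _ _ (by omega), Store.setVar_nvar_of_ne _ _ (by omega),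
        hn 0 (by omega), h0]
    · rw [Store.setVar_nvar_of_ne _ _ (by omega), Store.setVar_nvar_of_ne _ _ (by omega),
        hn 1 (by omega), h1]
    · intro m hm
      rw [Store.setVar_narr, Store.setVar_narr, hP.same.narr, hw m hm]
    -- The eliminations in level `i + 1` have left the dual system of level `i` intact.
    · refine (hD.congr hP.improves.probe).succ fun k hk v j hj => ?_
      rw [hP.improves.extend hk v]
      exact hP.residual k hk v trivial j hj
    · intro i' hi' j hj
      simp only [Store.setVar_farr]
      rcases Nat.lt_succ_iff_lt_or_eq.1 hi' with hi' | rfl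
      · rw [hC i' hi' j hj]
        refine sum_congr rfl fun k _ => ?_
        congr 1
        exact sum_congr rfl fun v _ => by rw [hP.other (i', k, j, v) hi'.ne]
      · rw [hD.gatePoly_succ j]
        refine sum_congr rfl fun k hk => ?_
        congr 1
        exact sum_congr rfl fun v _ => by rw [hP.label k (mem_range.1 hk) v trivial j hj]
  · rintro τ ⟨-, -, -, h1, hw, -, -, -, hC⟩
    exact ⟨h1, hw, hC⟩

/-- The branching program with the levels of `P` and the labels found in the memory `σ`. -/
def relabel (P : ABP F n) (σ : Store F) : ABP F n :=
  { P with label := fun i j j' v => σ.farr 0 (i, j, j', v) }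

/-- The original gate polynomials satisfy the recursion that defines those of the relabeled program.
-/
theorem relabel_gatePoly {P : ABP F n} {σ : Store F} (h : P.LabelsCorrect P.depth σ) {i j : ℕ}
    (hi : i ≤ P.depth) (hj : j < P.width i) :
    (P.relabel σ).gatePoly i j = P.gatePoly i j := by
  induction i generalizing j with
  | zero => rfl
  | succ i ih =>
    rw [h i hi j hj, gatePoly]
    exact sum_congr rfl fun k hk => by rw [ih (by omega) (mem_range.1 hk)]; rfl

end ABP

end

theorem mainTheorem3 :
    ∃ (R : Machine.Prog) (p : Polynomial ℕ),
      ∀ (F : Type*) [Field F] (n : ℕ) (P : ABP F n),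
        ∃ (t : ℕ) (σ : Machine.Store F) (P' : ABP F n),
          Machine.Exec P.blackBox R (Machine.initial P) t σ ∧
          t ≤ p.eval (P.depth + P.size + n) ∧
          Machine.Describes σ P' ∧
          P'.size ≤ p.eval (P.depth + P.size + n) ∧
          P'.poly = P.poly := by
  -- The time bound, read in `Polynomial ℕ`, is itself the polynomial; the extra summand `X` bounds
  -- the size of the output.
  refine ⟨ABP.reconstruct, ABP.totalTime Polynomial.X + Polynomial.X, fun F _ n P => ?_⟩
  obtain ⟨t, σ, he, ht, hd, hw, hC⟩ := ABP.runs_reconstruct P le_rfl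
  have hp : (ABP.totalTime Polynomial.X + Polynomial.X : Polynomial ℕ).eval
      (P.depth + P.size + n) =
      ABP.totalTime (P.depth + P.size + n) + (P.depth + P.size + n) := by
    simp [ABP.totalTime, ABP.levelTime, ABP.functionalTime, ABP.eliminateTime, ABP.queryTime,
      ABP.rowTime, Machine.loopTime]
  have hsize : (P.relabel σ).size = P.size := rfl
  refine ⟨t, σ, P.relabel σ, he, by omega, ⟨hd, hw, fun _ _ _ _ _ _ _ => rfl⟩, by omega, ?_⟩
  exact ABP.relabel_gatePoly hC le_rfl (P.width_pos _ le_rfl)
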